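/- Let $\mathbb T^3=\mathbb R^3/\mathbb Z^3$ and let $L^2_\sigma$ be the space of fields in $L^2(\mathbb T^3;\mathbb C^3)$ that are divergence-free in the sense of distributions. Let $u\in L^\infty([0,\infty);W^{1,\infty}(\mathbb T^3;\mathbb R^3))$ be divergence-free and time-periodic with period $\tau>0$ (so $u(t+\tau)=u(t)$ for a.e. $t\ge 0$). For $\varepsilon>0$ and $B_{\rm in}\in L^2_\sigma$, consider the kinematic dynamo equation $$\partial_t B+u\cdot\nabla B-B\cdot\nabla u=\varepsilon\Delta B,\qquad \nabla\cdot B=0,\qquad B(0)=B_{\rm in},$$ whose solutions are the weak solutions $B\in C([0,\infty);L^2_\sigma)$. Define the growth rates, as elements of $[-\infty,\infty]$ with $\log 0=-\infty$, by $$\gamma_\varepsilon(B_{\rm in})=\liminf_{t\to\infty}\frac1t\log\|B(t)\|_{L^2},\qquad \overline{\gamma_\varepsilon}(B_{\rm in})=\limsup_{t\to\infty}\frac1t\log\|B(t)\|_{L^2}.$$ Then for every $\varepsilon>0$ the following holds. 1. For every $B_{\rm in}\in L^2_\sigma$ the equation has exactly one solution on $[0,\infty)$, so that the growth rates are well defined.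 2. $\gamma_\varepsilon(B_{\rm in})=\overline{\gamma_\varepsilon}(B_{\rm in})$ for every $B_{\rm in}\in L^2_\sigma$. 3. The monodromy operator $T:L^2_\sigma\to L^2_\sigma$, $TB_{\rm in}=B(\tau)$, is bounded, linear and compact, and with $r(T)$ its spectral radius $$\max_{B_{\rm in}\neq0}\gamma_\varepsilon(B_{\rm in})=\max_{B_{\rm in}\neq0}\overline{\gamma_\varepsilon}(B_{\rm in})=\frac1\tau\log r(T).$$ -/

import Mathlib

open MeasureTheory Filter Topology
open scoped ContDiff ENNReal

noncomputable section

namespace KinematicDynamo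

/-- The three-dimensional torus `ℝ³ / ℤ³`; its `volume` is the Haar probability measure. -/
abbrev T3 : Type := UnitAddTorus (Fin 3)

/-- The complex Hilbert space `L²(𝕋³; ℂ³)`. Real magnetic fields are a special case. -/
abbrev L2 : Type := Lp (EuclideanSpace ℂ (Fin 3)) 2 (volume : Measure T3)

/-- Smooth functions on the torus: those whose `ℤ³`-periodic lift to `ℝ³` is `C^∞`. -/
def IsTest (φ : T3 → ℂ) : Prop :=
  ContDiff ℝ ∞ (fun y : Fin 3 → ℝ => φ (fun i => (y i : UnitAddCircle)))

/-- The partial derivative `∂φ/∂x_j` of a function on the torus. -/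
def partialDeriv (j : Fin 3) (φ : T3 → ℂ) (x : T3) : ℂ :=
  deriv (fun s : ℝ => φ (x + Pi.single j (s : UnitAddCircle))) 0

/-- The Laplacian `Δφ` of a function on the torus. -/
def laplacian (φ : T3 → ℂ) (x : T3) : ℂ :=
  ∑ j : Fin 3, partialDeriv j (partialDeriv j φ) x

/-! ### Velocity fields -/

/-- `v ∈ W^{1,∞}(𝕋³; ℝ³)`, with `v` and its weak first derivatives `G i j = ∂_j v_i` essentially
bounded by `M`. -/
def MemW1inftyWith (M : ℝ) (v : T3 → EuclideanSpace ℝ (Fin 3)) : Prop :=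
  AEStronglyMeasurable v volume ∧ (∀ᵐ x : T3, ‖v x‖ ≤ M) ∧
    ∃ G : Fin 3 → Fin 3 → T3 → ℝ,
      (∀ i j, AEStronglyMeasurable (G i j) volume) ∧ (∀ i j, ∀ᵐ x : T3, |G i j x| ≤ M) ∧
      ∀ φ : T3 → ℂ, IsTest φ → ∀ i j,
        ∫ x : T3, (v x i : ℂ) * partialDeriv j φ x = -∫ x : T3, (G i j x : ℂ) * φ x

/-- `u ∈ L^∞([0,∞); W^{1,∞}(𝕋³; ℝ³))`. -/
def MemLinftyW1infty (u : ℝ → T3 → EuclideanSpace ℝ (Fin 3)) : Prop :=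
  AEStronglyMeasurable (Function.uncurry u)
      (((volume : Measure ℝ).restrict (Set.Ici 0)).prod (volume : Measure T3)) ∧
    ∃ M : ℝ, ∀ᵐ t ∂((volume : Measure ℝ).restrict (Set.Ici 0)), MemW1inftyWith M (u t)

/-- `∇ · u(t) = 0` in the sense of distributions, for almost every `t ≥ 0`. -/
def IsDivFree (u : ℝ → T3 → EuclideanSpace ℝ (Fin 3)) : Prop :=
  ∀ᵐ t ∂((volume : Measure ℝ).restrict (Set.Ici 0)), ∀ φ : T3 → ℂ, IsTest φ →
    ∫ x : T3, ∑ j : Fin 3, (u t x j : ℂ) * partialDeriv j φ x = 0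

/-- `u(t + τ) = u(t)` for almost every `t ≥ 0`. -/
def IsTimePeriodic (τ : ℝ) (u : ℝ → T3 → EuclideanSpace ℝ (Fin 3)) : Prop :=
  ∀ᵐ t ∂((volume : Measure ℝ).restrict (Set.Ici 0)), u (t + τ) =ᵐ[volume] u t

/-! ### Divergence-free magnetic fields -/

/-- The covering map `ℝ³ → 𝕋³`. -/
def toT3 (y : Fin 3 → ℝ) : T3 := fun i => (y i : UnitAddCircle)

theorem isOpenQuotientMap_toT3 : IsOpenQuotientMap toT3 := by
  refine ⟨?_, ?_, ?_⟩
  · intro x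
    choose y hy using fun i => QuotientAddGroup.mk_surjective (x i)
    exact ⟨y, funext hy⟩
  · exact continuous_pi fun i => (AddCircle.continuous_mk' 1).comp (continuous_apply i)
  · exact IsOpenMap.piMap (fun _ => QuotientAddGroup.isOpenMap_coe)
      (Eventually.of_forall fun _ => QuotientAddGroup.mk_surjective)

theorem partialDeriv_toT3 (j : Fin 3) {φ : T3 → ℂ} (hφ : IsTest φ) (y : Fin 3 → ℝ) :
    partialDeriv j φ (toT3 y) = fderiv ℝ (fun y => φ (toT3 y)) y (Pi.single j 1) := by
  have h1 : HasFDerivAt (fun y => φ (toT3 y)) (fderiv ℝ (fun y => φ (toT3 y)) y) y :=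
    ((show ContDiff ℝ ∞ (fun y => φ (toT3 y)) from hφ).differentiable (by simp) y).hasFDerivAt
  have h3 := (h1.hasLineDerivAt (Pi.single j 1)).deriv
  rw [← h3]
  unfold partialDeriv
  congr 1
  funext s
  congr 1
  funext i
  by_cases h : i = j
  · subst h; simp [toT3]
  · simp [toT3, h]

theorem continuous_partialDeriv (j : Fin 3) {φ : T3 → ℂ} (hφ : IsTest φ) :
    Continuous (partialDeriv j φ) := by
  rw [isOpenQuotientMap_toT3.isQuotientMap.continuous_iff]
  have : partialDeriv j φ ∘ toT3 =
      fun y => fderiv ℝ (fun y => φ (toT3 y)) y (Pi.single j 1) :=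
    funext fun y => partialDeriv_toT3 j hφ y
  rw [this]
  exact ((show ContDiff ℝ ∞ (fun y => φ (toT3 y)) from hφ).continuous_fderiv (by simp)).clm_apply
    continuous_const

theorem integrable_mul_partialDeriv (B : L2) (j : Fin 3) {φ : T3 → ℂ} (hφ : IsTest φ) :
    Integrable (fun x : T3 => B x j * partialDeriv j φ x) volume := by
  have hB : Integrable (fun x : T3 => B x j) volume :=
    (((Lp.memLp B).integrable (by norm_num)).norm.mono'
      ((EuclideanSpace.proj (𝕜 := ℂ) j).continuous.comp_aestronglyMeasurable
        (Lp.memLp B).aestronglyMeasurable)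
      (Eventually.of_forall fun x => PiLp.norm_apply_le (B x) j))
  obtain ⟨C, hC⟩ := isCompact_univ.exists_bound_of_continuousOn
    (continuous_partialDeriv j hφ).continuousOn
  exact hB.mul_bdd (continuous_partialDeriv j hφ).aestronglyMeasurable
    (Eventually.of_forall fun x => hC x (Set.mem_univ x))

/-- The space `L²_σ(𝕋³; ℂ³)` of square-integrable fields that are divergence-free in the sense of
distributions. -/
def L2div : Submodule ℂ L2 where
  carrier := {B | ∀ φ : T3 → ℂ, IsTest φ →
    ∫ x : T3, ∑ j : Fin 3, B x j * partialDeriv j φ x = 0}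
  zero_mem' := by
    intro φ _
    refine integral_eq_zero_of_ae ?_
    filter_upwards [Lp.coeFn_zero (EuclideanSpace ℂ (Fin 3)) 2 (volume : Measure T3)] with x hx
    simp only [hx, Pi.zero_apply, PiLp.zero_apply, zero_mul, Finset.sum_const_zero]
  add_mem' := by
    intro A B hA hB φ hφ
    have h : (fun x : T3 => ∑ j : Fin 3, (A + B : L2) x j * partialDeriv j φ x) =ᵐ[volume]
        fun x => (∑ j : Fin 3, A x j * partialDeriv j φ x) +
          ∑ j : Fin 3, B x j * partialDeriv j φ x := by
      filter_upwards [Lp.coeFn_add A B] with x hx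
      simp only [hx, Pi.add_apply, PiLp.add_apply, add_mul, Finset.sum_add_distrib]
    rw [integral_congr_ae h, integral_add
      (integrable_finsetSum _ fun j _ => integrable_mul_partialDeriv A j hφ)
      (integrable_finsetSum _ fun j _ => integrable_mul_partialDeriv B j hφ), hA φ hφ, hB φ hφ,
      add_zero]
  smul_mem' := by
    intro c A hA φ hφ
    have h : (fun x : T3 => ∑ j : Fin 3, (c • A : L2) x j * partialDeriv j φ x) =ᵐ[volume]
        fun x => c * ∑ j : Fin 3, A x j * partialDeriv j φ x := by
      filter_upwards [Lp.coeFn_smul c A] with x hx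
      simp only [hx, Pi.smul_apply, PiLp.smul_apply, smul_eq_mul, Finset.mul_sum, mul_assoc]
    rw [integral_congr_ae h, integral_const_mul, hA φ hφ, mul_zero]

/-! ### The kinematic dynamo equation -/

/-- `B` is the solution on `[0,∞)` of
`∂ₜB + u·∇B - B·∇u = ε ΔB`, `∇·B = 0`, `B(0) = B₀`:
it is continuous in time with values in the divergence-free `L²` fields, and the equation holds in
the weak sense. Because `u` and `B` are divergence-free,
`(u·∇B - B·∇u)_i = ∑_j ∂_j (u_j B_i - u_i B_j)`, which is the `i`-th component of `-∇ × (u × B)`;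
the derivatives are moved to the test function and the equation is integrated in time. -/
structure IsSolution (u : ℝ → T3 → EuclideanSpace ℝ (Fin 3)) (ε : ℝ) (B₀ : L2div)
    (B : ℝ → L2div) : Prop where
  continuousOn : ContinuousOn B (Set.Ici 0)
  initial : B 0 = B₀
  weak : ∀ t : ℝ, 0 ≤ t → ∀ φ : T3 → ℂ, IsTest φ → ∀ i : Fin 3,
    ∫ x : T3, (B t : L2) x i * φ x =
      (∫ x : T3, (B₀ : L2) x i * φ x) +
      ∫ s in (0 : ℝ)..t,
        ((∫ x : T3, ∑ j : Fin 3,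
            ((u s x j : ℂ) * (B s : L2) x i - (u s x i : ℂ) * (B s : L2) x j) *
              partialDeriv j φ x) +
          (ε : ℂ) * ∫ x : T3, (B s : L2) x i * laplacian φ x)

/-- The dynamo growth rate `liminf_{t → ∞} (1/t) log ‖B(t)‖_{L²}`, with `log 0 = -∞`. -/
def growthRate (B : ℝ → L2div) : EReal :=
  liminf (fun t : ℝ => ((t⁻¹ : ℝ) : EReal) * ENNReal.log ‖B t‖ₑ) atTop

/-- The limsup dynamo growth rate `limsup_{t → ∞} (1/t) log ‖B(t)‖_{L²}`, with `log 0 = -∞`. -/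
def limsupGrowthRate (B : ℝ → L2div) : EReal :=
  limsup (fun t : ℝ => ((t⁻¹ : ℝ) : EReal) * ENNReal.log ‖B t‖ₑ) atTop

/-- `T` is the monodromy operator over the time `τ`: it maps each initial datum to the value at
time `τ` of the solution that starts from it. -/
def IsMonodromy (u : ℝ → T3 → EuclideanSpace ℝ (Fin 3)) (ε τ : ℝ) (T : L2div →L[ℂ] L2div) : Prop :=
  ∀ (B₀ : L2div) (B : ℝ → L2div), IsSolution u ε B₀ B → B τ = T B₀

end KinematicDynamo

end

/-! In Fourier coefficients the equation is a diagonal system c' = √λ a(s, B) - λ c, where λ runs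
over the eigenvalues of -εΔ and a(s, ·) is bounded from L² to ℓ² uniformly in s: the flux u_j B_i -
u_i B_j costs only the sup norm of u, and taking its divergence costs at most a multiple of √λ. In
Duhamel's formula the heat kernel absorbs this √λ, because ∫ λ e^{-2λ(t-s)} ds ≤ 1/2
(`norm_sq_integral_exp_smul_le`). A contraction then gives existence, Grönwall's inequality gives
uniqueness and bounds, and the damping of high modes over a short final time interval makes the
monodromy operator T a norm limit of finite-rank operators, hence compact. Antisymmetry of the flux
keeps the field solenoidal, and periodicity of u gives B(nτ) = Tⁿ B(0).

The remainder concerns orbits of a compact operator. Its nonzero eigenvalues can accumulate only at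
0, so between any two growth factors there is a circle |z| = r free of eigenvalues, on which z - T
is uniformly bounded below. Then an orbit that is infinitely often below rⁿ is always below C rⁿ:
the truncated resolvent sums Σ z^{-m-1} Tᵐ x stay bounded on the circle, and a discrete Cauchy
formula over roots of unity recovers Tⁿ x from them (`orbit_le_of_frequently`). So no orbit can
oscillate between two exponential rates, and liminf equals limsup.

For the maximum, Gelfand's formula bounds every limsup by (1/τ) log r(T). If r(T) > 0, a spectral
value of modulus r(T) is an eigenvalue and its eigenvector attains the bound; if r(T) = 0 the bound
is -∞ and every datum attains it. -/

noncomputable section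

namespace KinematicDynamo

/-! ### Growth of orbits of a compact operator -/

section Spectral

open Module End

variable {V : Type*} [NormedAddCommGroup V] [InnerProductSpace ℂ V]

/-- A compact operator has only finitely many eigenvalues outside a disc around `0`: there is no
sequence of distinct ones. -/
theorem not_injective_eigenvalues {T : V →L[ℂ] V} (hT : IsCompactOperator T) {δ : ℝ} (hδ : 0 < δ)
    {z : ℕ → ℂ} (hz : Function.Injective z) (hzδ : ∀ n, δ ≤ ‖z n‖)
    (hev : ∀ n, HasEigenvalue (T : End ℂ V) (z n)) : False := by
  choose v hv using fun n => (hev n).exists_hasEigenvector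
  have hli : LinearIndependent ℂ v := eigenvectors_linearIndependent' _ z hz v hv
  have hTv : ∀ n, T (v n) = z n • v n := fun n => (hv n).apply_eq_smul
  -- The eigenvectors span a T-invariant flag. In an orthonormal basis adapted to it T is triangular
  -- with diagonal entries `z n`, so the images of the basis vectors stay `δ` apart.
  let g := InnerProductSpace.gramSchmidtNormed ℂ v
  have hg : Orthonormal ℂ g := InnerProductSpace.gramSchmidtNormed_orthonormal hli
  have hspan : ∀ n, Submodule.span ℂ (g '' Set.Iio n) = Submodule.span ℂ (v '' Set.Iio n) := by
    intro n
    rw [InnerProductSpace.span_gramSchmidtNormed, InnerProductSpace.span_gramSchmidt_Iio]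
  have horth : ∀ n, ∀ w ∈ Submodule.span ℂ (v '' Set.Iio n), inner ℂ (g n) w = 0 := by
    intro n w hw
    rw [← hspan] at hw
    induction hw using Submodule.span_induction with
    | mem x hx =>
      obtain ⟨m, hm, rfl⟩ := hx
      exact hg.2 (ne_of_gt hm)
    | zero => simp
    | add x y _ _ hx hy => rw [inner_add_right, hx, hy, add_zero]
    | smul c x _ hx => rw [inner_smul_right, hx, mul_zero]
  have hmem : ∀ n, g n ∈ Submodule.span ℂ (v '' Set.Iic n) := by
    intro n
    rw [← InnerProductSpace.span_gramSchmidt_Iic (𝕜 := ℂ),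
      ← InnerProductSpace.span_gramSchmidtNormed]
    exact Submodule.subset_span ⟨n, Set.mem_Iic.2 le_rfl, rfl⟩
  have hTmem : ∀ n, ∀ w ∈ Submodule.span ℂ (v '' Set.Iic n),
      T w ∈ Submodule.span ℂ (v '' Set.Iic n) ∧
        T w - z n • w ∈ Submodule.span ℂ (v '' Set.Iio n) := by
    intro n w hw
    induction hw using Submodule.span_induction with
    | mem x hx =>
      obtain ⟨m, hm, rfl⟩ := hx
      have hm' : m ≤ n := hm
      refine ⟨?_, ?_⟩
      · rw [hTv]
        exact Submodule.smul_mem _ _ (Submodule.subset_span ⟨m, hm, rfl⟩)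
      · rw [hTv, ← sub_smul]
        rcases hm'.lt_or_eq with h | rfl
        · exact Submodule.smul_mem _ _ (Submodule.subset_span ⟨m, h, rfl⟩)
        · simp
    | zero => simp
    | add x y _ _ hx hy =>
      refine ⟨by rw [map_add]; exact Submodule.add_mem _ hx.1 hy.1, ?_⟩
      have := Submodule.add_mem _ hx.2 hy.2
      rw [map_add, smul_add]
      convert this using 1
      abel
    | smul c x _ hx =>
      refine ⟨by rw [map_smul]; exact Submodule.smul_mem _ _ hx.1, ?_⟩
      have := Submodule.smul_mem _ c hx.2
      rw [map_smul, smul_comm, ← smul_sub]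
      exact this
  have hsep : ∀ m n, m < n → δ ≤ ‖T (g n) - T (g m)‖ := by
    intro m n hmn
    have h1 : inner ℂ (g n) (T (g n) - T (g m)) = z n := by
      have h2 := horth n _ (hTmem n _ (hmem n)).2
      have h3 := horth n (T (g m)) (Submodule.span_mono
        (Set.image_mono (Set.Iic_subset_Iio.2 hmn)) (hTmem m _ (hmem m)).1)
      rw [inner_sub_right, inner_smul_right, inner_self_eq_norm_sq_to_K, hg.1 n] at h2
      rw [inner_sub_right, h3, sub_zero]
      simpa [sub_eq_zero] using h2
    calc δ ≤ ‖z n‖ := hzδ n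
      _ = ‖inner ℂ (g n) (T (g n) - T (g m))‖ := by rw [h1]
      _ ≤ ‖g n‖ * ‖T (g n) - T (g m)‖ := norm_inner_le_norm _ _
      _ = _ := by rw [hg.1 n, one_mul]
  -- A `δ`-separated sequence in the image of the unit ball has no Cauchy subsequence.
  obtain ⟨K, hK, hK'⟩ := hT.image_closedBall_subset_compact (1 : ℝ)
  obtain ⟨y, -, ψ, hψ, hψy⟩ := hK.tendsto_subseq (x := fun n => T (g n))
    (fun n => hK' ⟨g n, by simp [hg.1 n], rfl⟩)
  have hc := hψy.cauchySeq
  rw [Metric.cauchySeq_iff'] at hc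
  obtain ⟨N, hN⟩ := hc δ hδ
  have h1 := hN (N + 1) (Nat.le_succ N)
  rw [dist_eq_norm] at h1
  exact absurd h1 (not_lt.2 (hsep _ _ (hψ (Nat.lt_succ_self N))))

/-- Between any two positive radii there is a circle without eigenvalues of a given compact
operator. -/
theorem exists_radius_no_eigenvalue {T : V →L[ℂ] V} (hT : IsCompactOperator T) {p q : ℝ}
    (hp : 0 < p) (hpq : p < q) :
    ∃ r, p < r ∧ r < q ∧ ∀ z : ℂ, ‖z‖ = r → ¬ HasEigenvalue (T : End ℂ V) z := by
  by_contra! h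
  -- If every radius in the interval were the modulus of an eigenvalue, infinitely many radii would
  -- give distinct eigenvalues, all of modulus at least `p`.
  have hinf : (Set.Ioo p q).Infinite := Set.Ioo_infinite hpq
  choose! z hz hev using fun r (hr : p < r ∧ r < q) => h r hr.1 hr.2
  let s := hinf.natEmbedding
  refine not_injective_eigenvalues hT hp (z := fun n => z (s n)) ?_ ?_ ?_
  · intro m n hmn
    have := congrArg norm hmn
    simp only [hz _ (s m).2, hz _ (s n).2] at this
    exact s.injective (Subtype.ext this)
  · intro n
    rw [hz _ (s n).2]
    exact (s n).2.1.le
  · exact fun n => hev _ (s n).2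

/-- If a compact operator has no eigenvalue on the circle of radius `r > 0`, then `T - z` is
bounded below uniformly for `z` on this circle. -/
theorem exists_lower_bound_on_circle {T : V →L[ℂ] V} (hT : IsCompactOperator T) {r : ℝ}
    (hr : 0 < r) (h : ∀ z : ℂ, ‖z‖ = r → ¬ HasEigenvalue (T : End ℂ V) z) :
    ∃ c > 0, ∀ z : ℂ, ‖z‖ = r → ∀ y, c * ‖y‖ ≤ ‖z • y - T y‖ := by
  by_contra! hcon
  choose z hz y hy using fun n : ℕ => hcon (1 / ((n : ℝ) + 1)) (by positivity)
  have hy0 : ∀ n, y n ≠ 0 := by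
    intro n hn
    have := hy n
    simp [hn] at this
  -- Normalised approximate eigenvectors. Compactness makes `T (w n)` converge along a subsequence;
  -- then `z n • w n` has the same limit, and dividing by `z n`, which stays away from 0, makes `w
  -- n` itself converge to a unit eigenvector.
  let w := fun n => ((‖y n‖ : ℂ)⁻¹) • y n
  have hw : ∀ n, ‖w n‖ = 1 := fun n => by
    simp [w, norm_smul, hy0 n]
  have hwT : ∀ n, ‖z n • w n - T (w n)‖ ≤ 1 / ((n : ℝ) + 1) := by
    intro n
    have h1 : z n • w n - T (w n) = ((‖y n‖ : ℂ)⁻¹) • (z n • y n - T (y n)) := by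
      simp only [w, map_smul, smul_sub, smul_comm (z n)]
    rw [h1, norm_smul, norm_inv, Complex.norm_real, norm_norm,
      inv_mul_le_iff₀ (norm_pos_iff.2 (hy0 n))]
    linarith [hy n]
  have hwT0 : Tendsto (fun n => z n • w n - T (w n)) atTop (𝓝 0) :=
    squeeze_zero_norm hwT tendsto_one_div_add_atTop_nhds_zero_nat
  obtain ⟨K, hK, hK'⟩ := hT.image_closedBall_subset_compact (1 : ℝ)
  obtain ⟨x, -, ψ, hψ, hψx⟩ := hK.tendsto_subseq (x := fun n => T (w n))
    (fun n => hK' ⟨w n, by simp [hw n], rfl⟩)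
  obtain ⟨z₀, hz₀, φ, hφ, hφz⟩ := (isCompact_sphere (0 : ℂ) r).tendsto_subseq
    (x := fun n => z (ψ n)) (fun n => by simp [hz])
  have hz₀r : ‖z₀‖ = r := by simpa using hz₀
  have hz₀0 : z₀ ≠ 0 := by
    rw [← norm_pos_iff, hz₀r]; exact hr
  have h1 : Tendsto (fun n => T (w (ψ (φ n)))) atTop (𝓝 x) := hψx.comp hφ.tendsto_atTop
  have h2 : Tendsto (fun n => z (ψ (φ n)) • w (ψ (φ n))) atTop (𝓝 x) := by
    have := (hwT0.comp (hψ.comp hφ).tendsto_atTop).add h1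
    simpa using this
  have h3 : Tendsto (fun n => w (ψ (φ n))) atTop (𝓝 (z₀⁻¹ • x)) := by
    have hφz' : Tendsto (fun n => z (ψ (φ n))) atTop (𝓝 z₀) := hφz
    refine ((hφz'.inv₀ hz₀0).smul h2).congr fun n => ?_
    have : z (ψ (φ n)) ≠ 0 := by rw [← norm_pos_iff, hz]; exact hr
    rw [inv_smul_smul₀ this]
  have h4 : T (z₀⁻¹ • x) = x := tendsto_nhds_unique ((T.continuous.tendsto _).comp h3) h1
  have h5 : ‖z₀⁻¹ • x‖ = 1 := by
    refine tendsto_nhds_unique h3.norm ?_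
    simp only [hw]
    exact tendsto_const_nhds
  refine h z₀ hz₀r (hasEigenvalue_of_hasEigenvector (x := z₀⁻¹ • x) ⟨?_, ?_⟩)
  · rw [mem_eigenspace_iff]
    change T (z₀⁻¹ • x) = _
    rw [h4, smul_inv_smul₀ hz₀0]
  · rw [← norm_pos_iff, h5]; exact one_pos

/-- If `T - z` is bounded below on the circle of radius `r`, then an orbit that is infinitely often
below `r ^ n` is always below a multiple of `r ^ n`. -/
theorem orbit_le_of_frequently {T : V →L[ℂ] V} {r c : ℝ} (hr : 0 < r) (hc : 0 < c)
    (h : ∀ z : ℂ, ‖z‖ = r → ∀ y, c * ‖y‖ ≤ ‖z • y - T y‖) {x : V}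
    (hx : ∃ᶠ n : ℕ in atTop, ‖(T ^ n) x‖ ≤ r ^ n) :
    ∃ C > 0, ∀ n : ℕ, ‖(T ^ n) x‖ ≤ C * r ^ n := by
  refine ⟨r * (c⁻¹ * (‖x‖ + 1)), by positivity, fun n => ?_⟩
  -- `N` exceeds `n`, so the term of index `n` occurs in the sum and the `N`-th roots of unity
  -- separate it from the others. The final constant does not involve `N`.
  obtain ⟨N, hN, hNx⟩ := (frequently_atTop.1 hx) (n + 1)
  have hN0 : N ≠ 0 := by omega
  -- the resolvent sum at the point `z`
  let y : ℂ → V := fun z => ∑ m ∈ Finset.range N, (z⁻¹) ^ (m + 1) • (T ^ m) x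
  have hy : ∀ z : ℂ, ‖z‖ = r → ‖y z‖ ≤ c⁻¹ * (‖x‖ + 1) := by
    intro z hz
    have hz0 : z ≠ 0 := by rw [← norm_pos_iff, hz]; exact hr
    -- Telescoping leaves only the two end terms; the bound on the orbit at time `N` makes the last
    -- one of norm at most 1 on the circle.
    have h1 : z • y z - T (y z) = x - (z⁻¹) ^ N • (T ^ N) x := by
      have : ∀ m, z • ((z⁻¹) ^ (m + 1) • (T ^ m) x) - T ((z⁻¹) ^ (m + 1) • (T ^ m) x) =
          (z⁻¹) ^ m • (T ^ m) x - (z⁻¹) ^ (m + 1) • (T ^ (m + 1)) x := by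
        intro m
        rw [map_smul, smul_smul, pow_succ' z⁻¹, mul_inv_cancel_left₀ hz0, pow_succ' T]
        rfl
      simp only [y, Finset.smul_sum, map_sum, ← Finset.sum_sub_distrib, this]
      rw [Finset.sum_range_sub' (fun m => (z⁻¹) ^ m • (T ^ m) x)]
      simp
    have h2 := h z hz (y z)
    rw [h1] at h2
    have h3 : ‖(z⁻¹) ^ N • (T ^ N) x‖ ≤ 1 := by
      rw [norm_smul, norm_pow, norm_inv, hz, inv_pow, inv_mul_le_iff₀ (by positivity), mul_one]
      exact hNx
    rw [le_inv_mul_iff₀ hc]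
    exact h2.trans ((norm_sub_le _ _).trans (by gcongr))
  -- averaging over the roots of unity recovers the orbit
  obtain ⟨ζ, hζ⟩ : ∃ ζ : ℂ, IsPrimitiveRoot ζ N := ⟨_, Complex.isPrimitiveRoot_exp N hN0⟩
  have hζ1 : ‖ζ‖ = 1 := hζ.norm'_eq_one hN0
  have hζ0 : ζ ≠ 0 := hζ.ne_zero hN0
  have hr' : (r : ℂ) ≠ 0 := by exact_mod_cast hr.ne'
  have havg : ∑ k ∈ Finset.range N, (ζ ^ k * r) ^ (n + 1) • y (ζ ^ k * r) =
      (N : ℂ) • (T ^ n) x := by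
    simp only [y, Finset.smul_sum, smul_smul]
    rw [Finset.sum_comm, Finset.sum_eq_single n]
    · rw [← Finset.sum_smul]
      congr 1
      rw [Finset.sum_congr rfl (g := fun _ => (1 : ℂ))]
      · simp
      · intro k _
        rw [← mul_pow, mul_inv_cancel₀ (mul_ne_zero (pow_ne_zero _ hζ0) hr'), one_pow]
    · intro m hm hmn
      rw [← Finset.sum_smul]
      have hm' : m < N := Finset.mem_range.1 hm
      have : ∑ k ∈ Finset.range N, (ζ ^ k * r) ^ (n + 1) * (ζ ^ k * r)⁻¹ ^ (m + 1) = 0 := by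
        have hterm : ∀ k, (ζ ^ k * (r : ℂ)) ^ (n + 1) * (ζ ^ k * r)⁻¹ ^ (m + 1) =
            (r : ℂ) ^ (n + 1) * (r : ℂ)⁻¹ ^ (m + 1) * (ζ ^ ((n : ℤ) - m)) ^ k := by
          intro k
          have e1 : (ζ ^ ((n : ℤ) - m)) ^ k = (ζ ^ k) ^ (n + 1) * (ζ ^ k)⁻¹ ^ (m + 1) := by
            rw [← zpow_natCast, ← zpow_natCast ζ k, ← zpow_neg, ← zpow_natCast, ← zpow_natCast,
              ← zpow_mul, ← zpow_mul, ← zpow_mul, ← zpow_add₀ hζ0]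
            congr 1
            push_cast
            ring
          rw [e1, mul_inv, mul_pow, mul_pow]
          ring
        simp only [hterm]
        rw [← Finset.mul_sum]
        -- Both indices lie in `[0, N)` and differ, so `N` does not divide `n - m` and the geometric
        -- sum over the roots of unity vanishes.
        have hne : ζ ^ ((n : ℤ) - m) ≠ 1 := by
          rw [Ne, hζ.zpow_eq_one_iff_dvd]
          intro hd
          have h1 := Int.eq_zero_of_abs_lt_dvd hd (by
            rw [abs_lt]; constructor <;> omega)
          omega
        have h2 := geom_sum_eq hne N
        have h3 : (ζ ^ ((n : ℤ) - m)) ^ N = 1 := by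
          rw [← zpow_natCast, ← zpow_mul, mul_comm, zpow_mul, zpow_natCast, hζ.pow_eq_one, one_zpow]
        rw [h2, h3]
        simp
      rw [this, zero_smul]
    · intro hn
      exact absurd (Finset.mem_range.2 (by omega)) hn
  have hnorm : (N : ℝ) * ‖(T ^ n) x‖ ≤ N * (r * (c⁻¹ * (‖x‖ + 1)) * r ^ n) := by
    calc (N : ℝ) * ‖(T ^ n) x‖ = ‖(N : ℂ) • (T ^ n) x‖ := by rw [norm_smul]; simp
      _ ≤ ∑ k ∈ Finset.range N, ‖(ζ ^ k * r) ^ (n + 1) • y (ζ ^ k * r)‖ := by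
          rw [← havg]; exact norm_sum_le _ _
      _ ≤ ∑ k ∈ Finset.range N, (r * (c⁻¹ * (‖x‖ + 1)) * r ^ n) := by
          refine Finset.sum_le_sum fun k _ => ?_
          have hk : ‖ζ ^ k * (r : ℂ)‖ = r := by
            rw [norm_mul, norm_pow, hζ1, one_pow, one_mul, Complex.norm_real,
              Real.norm_of_nonneg hr.le]
          rw [norm_smul, norm_pow, hk]
          calc r ^ (n + 1) * ‖y (ζ ^ k * r)‖ ≤ r ^ (n + 1) * (c⁻¹ * (‖x‖ + 1)) := by
                gcongr; exact hy _ hk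
            _ = _ := by ring
      _ = _ := by simp
  exact le_of_mul_le_mul_left hnorm (by positivity)

end Spectral

/-! ### Exponential growth rates of trajectories sampled by an orbit. -/

section Rates

open Module End

variable {V : Type*} [NormedAddCommGroup V]

/-- After taking logarithms and dividing by `t`, the prefactor contributes `log D / t`, which tends
to 0. -/
theorem limsup_rate_le_of_norm_le {B : ℝ → V} {D q : ℝ} (hD : 0 < D)
    (h : ∀ᶠ t : ℝ in atTop, ‖B t‖ ≤ D * Real.exp (q * t)) :
    limsup (fun t : ℝ => ((t⁻¹ : ℝ) : EReal) * ENNReal.log ‖B t‖ₑ) atTop ≤ (q : EReal) := by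
  have hlim : Tendsto (fun t : ℝ => ((t⁻¹ * Real.log D + q : ℝ) : EReal)) atTop (𝓝 (q : EReal)) := by
    rw [EReal.tendsto_coe]
    have := (tendsto_inv_atTop_zero.mul_const (Real.log D)).add_const q
    simpa using this
  rw [← hlim.limsup_eq]
  refine limsup_le_limsup ?_
  filter_upwards [h, eventually_gt_atTop 0] with t ht ht0
  have h1 : ENNReal.log ‖B t‖ₑ ≤ ((Real.log D + q * t : ℝ) : EReal) := by
    have h2 : ‖B t‖ₑ ≤ ENNReal.ofReal (D * Real.exp (q * t)) := by
      rw [← ofReal_norm]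
      exact ENNReal.ofReal_le_ofReal ht
    refine (ENNReal.log_monotone h2).trans (le_of_eq ?_)
    rw [ENNReal.log_ofReal_of_pos (by positivity), Real.log_mul hD.ne' (Real.exp_pos _).ne',
      Real.log_exp]
  calc ((t⁻¹ : ℝ) : EReal) * ENNReal.log ‖B t‖ₑ
      ≤ ((t⁻¹ : ℝ) : EReal) * ((Real.log D + q * t : ℝ) : EReal) :=
        mul_le_mul_of_nonneg_left h1 (by exact_mod_cast (inv_pos.2 ht0).le)
    _ = ((t⁻¹ * Real.log D + q : ℝ) : EReal) := by
        rw [← EReal.coe_mul]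
        congr 1
        field_simp

theorem le_liminf_rate_of_le_norm {B : ℝ → V} {D q : ℝ} (hD : 0 < D)
    (h : ∀ᶠ t : ℝ in atTop, D * Real.exp (q * t) ≤ ‖B t‖) :
    (q : EReal) ≤ liminf (fun t : ℝ => ((t⁻¹ : ℝ) : EReal) * ENNReal.log ‖B t‖ₑ) atTop := by
  have hlim : Tendsto (fun t : ℝ => ((t⁻¹ * Real.log D + q : ℝ) : EReal)) atTop (𝓝 (q : EReal)) := by
    rw [EReal.tendsto_coe]
    have := (tendsto_inv_atTop_zero.mul_const (Real.log D)).add_const q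
    simpa using this
  rw [← hlim.liminf_eq]
  refine liminf_le_liminf ?_
  filter_upwards [h, eventually_gt_atTop 0] with t ht ht0
  have h1 : ((Real.log D + q * t : ℝ) : EReal) ≤ ENNReal.log ‖B t‖ₑ := by
    have h2 : ENNReal.ofReal (D * Real.exp (q * t)) ≤ ‖B t‖ₑ := by
      rw [← ofReal_norm]
      exact ENNReal.ofReal_le_ofReal ht
    refine le_trans (le_of_eq ?_) (ENNReal.log_monotone h2)
    rw [ENNReal.log_ofReal_of_pos (by positivity), Real.log_mul hD.ne' (Real.exp_pos _).ne',
      Real.log_exp]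
  calc ((t⁻¹ * Real.log D + q : ℝ) : EReal)
      = ((t⁻¹ : ℝ) : EReal) * ((Real.log D + q * t : ℝ) : EReal) := by
        rw [← EReal.coe_mul]
        congr 1
        field_simp
    _ ≤ ((t⁻¹ : ℝ) : EReal) * ENNReal.log ‖B t‖ₑ :=
        mul_le_mul_of_nonneg_left h1 (by exact_mod_cast (inv_pos.2 ht0).le)

variable [InnerProductSpace ℂ V]

/-- `B` is sampled at the multiples of `τ` by the orbit of `x` under `T`, and its norm grows at most
by a fixed factor over a time `τ`. -/
structure IsSampledBy (τ : ℝ) (T : V →L[ℂ] V) (x : V) (B : ℝ → V) : Prop where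
  apply_nat_mul : ∀ n : ℕ, B (n * τ) = (T ^ n) x
  exists_bound : ∃ C > 0, ∀ s t : ℝ, 0 ≤ s → s ≤ t → t ≤ s + τ → ‖B t‖ ≤ C * ‖B s‖

namespace IsSampledBy

variable {τ : ℝ} {T : V →L[ℂ] V} {x : V} {B : ℝ → V}

/-- With `n = ⌊t / τ⌋`, the one-period bound compares `B t` with the sample preceding it. The factor
`exp (|p| τ)` pays for replacing `n τ` by `t`, whatever the sign of `p`. -/
theorem limsup_rate_le (hB : IsSampledBy τ T x B) (hτ : 0 < τ) {D p : ℝ} (hD : 0 < D)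
    (h : ∀ n : ℕ, ‖(T ^ n) x‖ ≤ D * Real.exp (p * τ) ^ n) :
    limsup (fun t : ℝ => ((t⁻¹ : ℝ) : EReal) * ENNReal.log ‖B t‖ₑ) atTop ≤ (p : EReal) := by
  obtain ⟨C, hC, hCB⟩ := hB.exists_bound
  refine limsup_rate_le_of_norm_le (D := C * (D * Real.exp (|p| * τ))) (by positivity) ?_
  filter_upwards [eventually_ge_atTop 0] with t ht
  have h1 : (⌊t / τ⌋₊ : ℝ) * τ ≤ t := by
    have := Nat.floor_le (div_nonneg ht hτ.le)
    rwa [le_div_iff₀ hτ] at this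
  have h2 : t < ((⌊t / τ⌋₊ : ℝ) + 1) * τ := by
    have := Nat.lt_floor_add_one (t / τ)
    rwa [div_lt_iff₀ hτ] at this
  set n := ⌊t / τ⌋₊
  have h3 := hCB (n * τ) t (by positivity) h1 (by linarith)
  rw [hB.apply_nat_mul] at h3
  have h4 : p * τ * n ≤ |p| * τ + p * t := by
    have : p * (n * τ - t) ≤ |p| * τ := by
      calc p * (n * τ - t) ≤ |p * (n * τ - t)| := le_abs_self _
        _ = |p| * |n * τ - t| := abs_mul _ _
        _ ≤ |p| * τ := by
          gcongr
          rw [abs_le]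
          constructor <;> linarith
    linarith
  calc ‖B t‖ ≤ C * (D * Real.exp (p * τ) ^ n) := h3.trans (by gcongr; exact h n)
    _ = C * (D * Real.exp (p * τ * n)) := by rw [← Real.exp_nat_mul, mul_comm (n : ℝ)]
    _ ≤ C * (D * Real.exp (|p| * τ + p * t)) := by gcongr
    _ = _ := by rw [Real.exp_add]; ring

theorem le_liminf_rate (hB : IsSampledBy τ T x B) (hτ : 0 < τ) {D p : ℝ} (hD : 0 < D)
    (h : ∀ᶠ n : ℕ in atTop, D * Real.exp (p * τ) ^ n ≤ ‖(T ^ n) x‖) :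
    (p : EReal) ≤ liminf (fun t : ℝ => ((t⁻¹ : ℝ) : EReal) * ENNReal.log ‖B t‖ₑ) atTop := by
  obtain ⟨C, hC, hCB⟩ := hB.exists_bound
  refine le_liminf_rate_of_le_norm (D := C⁻¹ * (D * Real.exp (-(|p| * τ)))) (by positivity) ?_
  obtain ⟨N, hN⟩ := eventually_atTop.1 h
  filter_upwards [eventually_ge_atTop (N * τ)] with t htN
  have ht : 0 ≤ t := le_trans (by positivity) htN
  have h1 : (⌊t / τ⌋₊ : ℝ) * τ ≤ t := by
    have := Nat.floor_le (div_nonneg ht hτ.le)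
    rwa [le_div_iff₀ hτ] at this
  have h2 : t < ((⌊t / τ⌋₊ : ℝ) + 1) * τ := by
    have := Nat.lt_floor_add_one (t / τ)
    rwa [div_lt_iff₀ hτ] at this
  have hNn : N ≤ ⌊t / τ⌋₊ := by
    rw [Nat.le_floor_iff (div_nonneg ht hτ.le), le_div_iff₀ hτ]
    exact htN
  set n := ⌊t / τ⌋₊
  -- For a lower bound on `B t` the comparison is with the sample that follows, hence `n + 1`.
  have h3 := hCB t ((n + 1 : ℕ) * τ) ht (by push_cast; linarith) (by push_cast; linarith)
  rw [hB.apply_nat_mul] at h3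
  have h4 : p * t - |p| * τ ≤ p * τ * (n + 1 : ℕ) := by
    have : p * (t - (n + 1 : ℕ) * τ) ≤ |p| * τ := by
      calc p * (t - (n + 1 : ℕ) * τ) ≤ |p * (t - (n + 1 : ℕ) * τ)| := le_abs_self _
        _ = |p| * |t - (n + 1 : ℕ) * τ| := abs_mul _ _
        _ ≤ |p| * τ := by
          gcongr
          push_cast
          rw [abs_le]
          constructor <;> linarith
    linarith
  rw [mul_assoc, inv_mul_le_iff₀ hC]
  calc D * Real.exp (-(|p| * τ)) * Real.exp (p * t)
      = D * Real.exp (p * t - |p| * τ) := by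
        rw [mul_assoc, ← Real.exp_add]; congr 2; ring
    _ ≤ D * Real.exp (p * τ * (n + 1 : ℕ)) := by gcongr
    _ = D * Real.exp (p * τ) ^ (n + 1) := by rw [← Real.exp_nat_mul, mul_comm ((n + 1 : ℕ) : ℝ)]
    _ ≤ ‖(T ^ (n + 1)) x‖ := hN _ (by omega)
    _ ≤ C * ‖B t‖ := h3

/-- The exponential growth rate of a trajectory sampled by an orbit of a compact operator exists as
a limit. -/
theorem liminf_rate_eq_limsup_rate (hB : IsSampledBy τ T x B) (hτ : 0 < τ)
    (hT : IsCompactOperator T) :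
    liminf (fun t : ℝ => ((t⁻¹ : ℝ) : EReal) * ENNReal.log ‖B t‖ₑ) atTop =
      limsup (fun t : ℝ => ((t⁻¹ : ℝ) : EReal) * ENNReal.log ‖B t‖ₑ) atTop := by
  refine le_antisymm liminf_le_limsup ?_
  by_contra! hlt
  obtain ⟨p, hp, hp'⟩ := EReal.lt_iff_exists_real_btwn.1 hlt
  obtain ⟨q, hq, hq'⟩ := EReal.lt_iff_exists_real_btwn.1 hp'
  have hpq : p * τ < q * τ := mul_lt_mul_of_pos_right (by exact_mod_cast hq) hτ
  obtain ⟨r, hr, hr', hrT⟩ := exists_radius_no_eigenvalue hT (Real.exp_pos _)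
    (Real.exp_lt_exp.2 hpq)
  have hr0 : 0 < r := (Real.exp_pos _).trans hr
  obtain ⟨c, hc, hcT⟩ := exists_lower_bound_on_circle hT hr0 hrT
  -- Here `exp (p τ) < r < exp (q τ)`. If the orbit is below `r ^ n` infinitely often, it always is
  -- up to a constant, and the limsup is at most `q`; otherwise it is eventually above, and the
  -- liminf is at least `p`. Both are excluded.
  by_cases hfr : ∃ᶠ n : ℕ in atTop, ‖(T ^ n) x‖ ≤ r ^ n
  · obtain ⟨C, hC, hCx⟩ := orbit_le_of_frequently hr0 hc hcT hfr
    exact absurd hq' (not_lt.2 (hB.limsup_rate_le hτ hC fun n => (hCx n).trans (by gcongr)))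
  · refine absurd hp (not_lt.2 (hB.le_liminf_rate hτ one_pos ?_))
    filter_upwards [not_frequently.1 hfr] with n hn
    rw [one_mul]
    exact (pow_le_pow_left₀ (Real.exp_pos _).le hr.le n).trans (not_le.1 hn).le

/-- Gelfand's formula: for `p` above the right-hand side, `‖T ^ n‖ ≤ exp (p τ) ^ n` eventually.
Arguing by contradiction with a real `p` also covers spectral radius 0. -/
theorem limsup_rate_le_log_spectralRadius [CompleteSpace V] (hB : IsSampledBy τ T x B)
    (hτ : 0 < τ) :
    limsup (fun t : ℝ => ((t⁻¹ : ℝ) : EReal) * ENNReal.log ‖B t‖ₑ) atTop ≤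
      ((τ⁻¹ : ℝ) : EReal) * ENNReal.log (spectralRadius ℂ T) := by
  by_contra! hlt
  obtain ⟨p, hp, hp'⟩ := EReal.lt_iff_exists_real_btwn.1 hlt
  have hr : spectralRadius ℂ T < ENNReal.ofReal (Real.exp (p * τ)) := by
    by_contra! hle
    refine absurd hp (not_lt.2 ?_)
    have h1 := ENNReal.log_monotone hle
    rw [ENNReal.log_ofReal_of_pos (Real.exp_pos _), Real.log_exp] at h1
    calc (p : EReal) = ((τ⁻¹ : ℝ) : EReal) * ((p * τ : ℝ) : EReal) := by
          rw [← EReal.coe_mul]; congr 1; field_simp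
      _ ≤ _ := mul_le_mul_of_nonneg_left h1 (by exact_mod_cast (inv_pos.2 hτ).le)
  have hev : ∀ᶠ n : ℕ in atTop, ‖T ^ n‖ ≤ Real.exp (p * τ) ^ n := by
    have h1 := (spectrum.pow_nnnorm_pow_one_div_tendsto_nhds_spectralRadius T).eventually_lt_const hr
    filter_upwards [h1, eventually_gt_atTop 0] with n hn hn0
    have h2 := ENNReal.rpow_le_rpow hn.le (Nat.cast_nonneg n : (0 : ℝ) ≤ n)
    rw [← ENNReal.rpow_mul, one_div, inv_mul_cancel₀ (by positivity), ENNReal.rpow_one,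
      ENNReal.rpow_natCast, ← ENNReal.ofReal_pow (Real.exp_pos _).le] at h2
    have h3 := ENNReal.toReal_mono ENNReal.ofReal_ne_top h2
    rw [ENNReal.toReal_ofReal (by positivity)] at h3
    simpa using h3
  obtain ⟨N, hN⟩ := eventually_atTop.1 hev
  obtain ⟨C, hC, hCx⟩ : ∃ C > 0, ∀ n : ℕ, ‖(T ^ n) x‖ ≤ C * Real.exp (p * τ) ^ n := by
    -- The sum absorbs the finitely many times before Gelfand's bound applies, `‖x‖` handles the
    -- later ones, and `1` keeps the constant positive.
    refine ⟨‖x‖ + 1 + ∑ m ∈ Finset.range N, ‖(T ^ m) x‖ / Real.exp (p * τ) ^ m,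
      by positivity, fun n => ?_⟩
    rw [add_mul]
    rcases lt_or_ge n N with hn | hn
    · have h1 : ‖(T ^ n) x‖ / Real.exp (p * τ) ^ n ≤
          ∑ m ∈ Finset.range N, ‖(T ^ m) x‖ / Real.exp (p * τ) ^ m :=
        Finset.single_le_sum (f := fun m => ‖(T ^ m) x‖ / Real.exp (p * τ) ^ m)
          (fun m _ => by positivity) (Finset.mem_range.2 hn)
      rw [div_le_iff₀ (by positivity)] at h1
      have h2 : 0 ≤ (‖x‖ + 1) * Real.exp (p * τ) ^ n := by positivity
      linarith
    · have h1 : ‖(T ^ n) x‖ ≤ Real.exp (p * τ) ^ n * ‖x‖ :=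
        ((T ^ n).le_opNorm x).trans (by gcongr; exact hN n hn)
      have h2 : 0 ≤ (∑ m ∈ Finset.range N, ‖(T ^ m) x‖ / Real.exp (p * τ) ^ m) *
        Real.exp (p * τ) ^ n := by positivity
      have h3 : 0 < Real.exp (p * τ) ^ n := by positivity
      linarith
  exact absurd hp' (not_lt.2 (hB.limsup_rate_le hτ hC hCx))

end IsSampledBy

/-- Some nonzero initial point realises the spectral radius of a compact operator as the growth rate
of every trajectory sampled by its orbit. -/
theorem exists_log_spectralRadius_le_liminf_rate [CompleteSpace V] [Nontrivial V] {τ : ℝ}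
    (hτ : 0 < τ) {T : V →L[ℂ] V} (hT : IsCompactOperator T) :
    ∃ x : V, x ≠ 0 ∧ ∀ B : ℝ → V, IsSampledBy τ T x B →
      ((τ⁻¹ : ℝ) : EReal) * ENNReal.log (spectralRadius ℂ T) ≤
        liminf (fun t : ℝ => ((t⁻¹ : ℝ) : EReal) * ENNReal.log ‖B t‖ₑ) atTop := by
  obtain ⟨z, hz, hzr⟩ := spectrum.exists_nnnorm_eq_spectralRadius T
  -- If `z = 0` the claimed lower bound is `-∞`. Otherwise the Fredholm alternative makes `z` an
  -- eigenvalue.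
  rcases eq_or_ne z 0 with rfl | hz0
  · obtain ⟨x, hx⟩ := exists_ne (0 : V)
    refine ⟨x, hx, fun B _ => ?_⟩
    rw [← hzr]
    simp [EReal.coe_mul_bot_of_pos (inv_pos.2 hτ)]
  · obtain ⟨x, hx⟩ := ((hT.hasEigenvalue_iff_mem_spectrum hz0).2 hz).exists_hasEigenvector
    have hTx : T x = z • x := hx.apply_eq_smul
    refine ⟨x, hx.2, fun B hB => ?_⟩
    have hpow : ∀ n : ℕ, (T ^ n) x = z ^ n • x := by
      intro n
      induction n with
      | zero => simp
      | succ n ih =>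
        rw [pow_succ', mul_apply_eq_comp, ih, map_smul, hTx, smul_smul, pow_succ]
    have hzp : 0 < ‖z‖ := norm_pos_iff.2 hz0
    have hrate : ((τ⁻¹ : ℝ) : EReal) * ENNReal.log (spectralRadius ℂ T) =
        ((τ⁻¹ * Real.log ‖z‖ : ℝ) : EReal) := by
      rw [← hzr, ← enorm_eq_nnnorm, ← ofReal_norm, ENNReal.log_ofReal_of_pos hzp,
        EReal.coe_mul]
    rw [hrate]
    refine hB.le_liminf_rate hτ (norm_pos_iff.2 hx.2) (Eventually.of_forall fun n => ?_)
    have : τ⁻¹ * Real.log ‖z‖ * τ = Real.log ‖z‖ := by field_simp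
    rw [hpow, norm_smul, norm_pow, this, Real.exp_log hzp, mul_comm]

end Rates

/-! ### Duhamel's formula with bounded measurable forcing -/

section Duhamel

/-- Measurable and bounded on bounded sets. -/
structure LocBdd (f : ℝ → ℂ) : Prop where
  meas : StronglyMeasurable f
  bdd : ∀ R : ℝ, ∃ C, ∀ s, |s| ≤ R → ‖f s‖ ≤ C

namespace LocBdd

variable {f g : ℝ → ℂ}

theorem of_continuous (hf : Continuous f) : LocBdd f where
  meas := hf.stronglyMeasurable
  bdd R := by
    obtain ⟨C, hC⟩ := (isCompact_Icc (a := -R) (b := R)).exists_bound_of_continuousOn hf.continuousOn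
    exact ⟨C, fun s hs => hC s (abs_le.1 hs)⟩

theorem smul {φ : ℝ → ℝ} (hφ : Continuous φ) (hf : LocBdd f) : LocBdd fun s => φ s • f s where
  meas := hφ.stronglyMeasurable.smul hf.meas
  bdd R := by
    obtain ⟨C, hC⟩ := hf.bdd R
    obtain ⟨D, hD⟩ := (isCompact_Icc (a := -R) (b := R)).exists_bound_of_continuousOn hφ.continuousOn
    refine ⟨D * C, fun s hs => ?_⟩
    have h1 := hD s (abs_le.1 hs)
    rw [norm_smul]
    exact mul_le_mul h1 (hC s hs) (norm_nonneg _) ((norm_nonneg _).trans h1)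

theorem sub (hf : LocBdd f) (hg : LocBdd g) : LocBdd fun s => f s - g s where
  meas := hf.meas.sub hg.meas
  bdd R := by
    obtain ⟨C, hC⟩ := hf.bdd R
    obtain ⟨D, hD⟩ := hg.bdd R
    exact ⟨C + D, fun s hs => (norm_sub_le _ _).trans (add_le_add (hC s hs) (hD s hs))⟩

theorem exists_bound_uIcc (hf : LocBdd f) (a b : ℝ) : ∃ C, ∀ s ∈ Set.uIcc a b, ‖f s‖ ≤ C := by
  obtain ⟨C, hC⟩ := hf.bdd (max |a| |b|)
  refine ⟨C, fun s hs => hC s ?_⟩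
  rw [Set.mem_uIcc] at hs
  rw [abs_le]
  have := le_max_left |a| |b|
  have := le_max_right |a| |b|
  have := neg_abs_le a
  have := neg_abs_le b
  have := le_abs_self a
  have := le_abs_self b
  rcases hs with hs | hs <;> constructor <;> linarith

theorem intervalIntegrable (hf : LocBdd f) (a b : ℝ) : IntervalIntegrable f volume a b := by
  obtain ⟨C, hC⟩ := hf.exists_bound_uIcc a b
  rw [intervalIntegrable_iff]
  refine Measure.integrableOn_of_bounded (M := C) (by simp) hf.meas.aestronglyMeasurable ?_
  filter_upwards [ae_restrict_mem measurableSet_uIoc] with s hs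
  exact hC s (Set.uIoc_subset_uIcc hs)

theorem intervalIntegrable_norm_sq (hf : LocBdd f) (a b : ℝ) :
    IntervalIntegrable (fun s => ‖f s‖ ^ 2) volume a b := by
  obtain ⟨C, hC⟩ := hf.exists_bound_uIcc a b
  rw [intervalIntegrable_iff]
  refine Measure.integrableOn_of_bounded (M := C ^ 2) (by simp)
    (hf.meas.norm.pow 2).aestronglyMeasurable ?_
  filter_upwards [ae_restrict_mem measurableSet_uIoc] with s hs
  rw [norm_pow, norm_norm]
  exact pow_le_pow_left₀ (norm_nonneg _) (hC s (Set.uIoc_subset_uIcc hs)) 2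

theorem absolutelyContinuousOnInterval_integral (hf : LocBdd f) (a b : ℝ) :
    AbsolutelyContinuousOnInterval (fun t => ∫ s in a..t, f s) a b := by
  obtain ⟨C, hC⟩ := hf.exists_bound_uIcc a b
  refine LipschitzOnWith.absolutelyContinuousOnInterval (K := C.toNNReal)
    (LipschitzOnWith.of_dist_le_mul fun x hx y hy => ?_)
  rw [dist_eq_norm, intervalIntegral.integral_interval_sub_left (hf.intervalIntegrable _ _)
    (hf.intervalIntegrable _ _), Real.dist_eq]
  refine intervalIntegral.norm_integral_le_of_norm_le_const fun s hs => ?_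
  exact (hC s (Set.uIcc_subset_uIcc hy hx (Set.uIoc_subset_uIcc hs))).trans
    (Real.le_coe_toNNReal C)

end LocBdd

/-- Since the forcing is only measurable, derivatives exist only almost everywhere. The difference
of `h` and the primitive of `g` is absolutely continuous with zero derivative a.e., hence constant.
-/
theorem integral_eq_sub_of_ae_hasDerivAt {h g : ℝ → ℂ} {a b : ℝ}
    (hh : AbsolutelyContinuousOnInterval h a b) (hg : LocBdd g)
    (hd : ∀ᵐ s : ℝ, s ∈ Set.uIcc a b → HasDerivAt h (g s) s) :
    ∫ s in a..b, g s = h b - h a := by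
  obtain ⟨C, hC⟩ := AbsolutelyContinuousOnInterval.const_of_ae_hasDerivAt_zero
    (hh.sub (hg.absolutelyContinuousOnInterval_integral a b)) (by
      filter_upwards [hd, (hg.intervalIntegrable a b).ae_hasDerivAt_integral] with s h1 h2 hs
      simpa using (h1 hs).sub (h2 hs a Set.left_mem_uIcc))
  have h1 := hC a Set.left_mem_uIcc
  have h2 := hC b Set.right_mem_uIcc
  simp only [Pi.sub_apply, intervalIntegral.integral_same, sub_zero] at h1 h2
  rw [h1, ← h2]
  ring

/-- The fundamental theorem of calculus for `e ^ (μ t) (c + ∫₀ᵗ g)`. -/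
theorem exp_smul_integral_eq {g : ℝ → ℂ} (hg : LocBdd g) (μ : ℝ) (c : ℂ) (t : ℝ) :
    ∫ s in (0 : ℝ)..t, (μ • Real.exp (μ * s) • (c + ∫ r in (0 : ℝ)..s, g r) +
      Real.exp (μ * s) • g s) = Real.exp (μ * t) • (c + ∫ r in (0 : ℝ)..t, g r) - c := by
  have hE : Continuous fun s : ℝ => Real.exp (μ * s) := by fun_prop
  have hint : Continuous fun s => ∫ r in (0 : ℝ)..s, g r :=
    intervalIntegral.continuous_primitive (fun a b => hg.intervalIntegrable a b) 0
  have hE' : AbsolutelyContinuousOnInterval (fun s : ℝ => Real.exp (μ * s)) 0 t :=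
    ContDiffOn.absolutelyContinuousOnInterval (by fun_prop)
  have hc : AbsolutelyContinuousOnInterval (fun _ : ℝ => c) 0 t :=
    ContDiffOn.absolutelyContinuousOnInterval contDiffOn_const
  have hac := hE'.smul (hc.add (hg.absolutelyContinuousOnInterval_integral 0 t))
  have h1 : LocBdd fun s => μ • Real.exp (μ * s) • (c + ∫ r in (0 : ℝ)..s, g r) +
      Real.exp (μ * s) • g s := by
    -- The sign is reversed so that the integrand becomes a difference, as in `LocBdd.sub`.
    have h2 : LocBdd fun s => (-μ * Real.exp (μ * s)) • (c + ∫ r in (0 : ℝ)..s, g r) :=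
      .of_continuous (by fun_prop)
    have h3 := (hg.smul hE).sub h2
    convert h3 using 2 with s
    rw [smul_smul, neg_mul, neg_smul, sub_neg_eq_add, add_comm]
  rw [integral_eq_sub_of_ae_hasDerivAt hac h1]
  · simp
  · filter_upwards [(hg.intervalIntegrable 0 t).ae_hasDerivAt_integral] with s hs hst
    have h2 : HasDerivAt (fun s : ℝ => Real.exp (μ * s)) (Real.exp (μ * s) * μ) s := by
      have := ((hasDerivAt_id s).const_mul μ).exp
      simpa using this
    have h3 := h2.smul ((hs hst 0 Set.left_mem_uIcc).const_add c)
    refine h3.congr_deriv ?_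
    rw [add_comm, mul_comm, smul_smul]

/-- Duhamel's formula for `c' = f - μ c`. -/
theorem eq_integral_iff_eq_duhamel {f c : ℝ → ℂ} (hf : LocBdd f) (hc : Continuous c) (μ : ℝ)
    (c₀ : ℂ) :
    (∀ t, 0 ≤ t → c t = c₀ + ∫ s in (0 : ℝ)..t, (f s - μ • c s)) ↔
      ∀ t, 0 ≤ t → c t = Real.exp (-μ * t) •
        (c₀ + ∫ s in (0 : ℝ)..t, Real.exp (μ * s) • f s) := by
  constructor
  · intro h t ht
    -- With `g = f - μ c` the bracket is `c` itself, so the two terms in `μ c` cancel. The converse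
    -- uses the same identity with `-μ` and `g = exp (μ s) f`.
    have h1 := exp_smul_integral_eq (hf.sub ((LocBdd.of_continuous hc).smul
      (continuous_const (y := μ)))) μ c₀ t
    rw [← h t ht] at h1
    have h2 : ∫ s in (0 : ℝ)..t, (μ • Real.exp (μ * s) • (c₀ + ∫ r in (0 : ℝ)..s, (f r - μ • c r)) +
        Real.exp (μ * s) • (f s - μ • c s)) = ∫ s in (0 : ℝ)..t, Real.exp (μ * s) • f s := by
      refine intervalIntegral.integral_congr fun s hs => ?_
      rw [Set.uIcc_of_le ht] at hs
      rw [← h s hs.1, smul_sub, smul_comm μ]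
      abel
    rw [h2] at h1
    rw [h1, add_sub_cancel, smul_smul, ← Real.exp_add]
    simp
  · intro h t ht
    have h1 := exp_smul_integral_eq (hf.smul (φ := fun s => Real.exp (μ * s)) (by fun_prop))
      (-μ) c₀ t
    rw [← h t ht] at h1
    rw [eq_add_of_sub_eq' h1.symm]
    congr 1
    refine intervalIntegral.integral_congr fun s hs => ?_
    rw [Set.uIcc_of_le ht] at hs
    rw [← h s hs.1, smul_smul (Real.exp _), ← Real.exp_add, neg_smul]
    simp [sub_eq_neg_add]

/-- Cauchy–Schwarz, from the discriminant of the nonnegative quadratic `x ↦ ∫ (x g + h) ^ 2`. -/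
theorem sq_integral_mul_le {g h : ℝ → ℝ} {r q : ℝ} (hrq : r ≤ q)
    (hg : IntervalIntegrable (fun s => g s ^ 2) volume r q)
    (hgh : IntervalIntegrable (fun s => g s * h s) volume r q)
    (hh : IntervalIntegrable (fun s => h s ^ 2) volume r q) :
    (∫ s in r..q, g s * h s) ^ 2 ≤ (∫ s in r..q, g s ^ 2) * ∫ s in r..q, h s ^ 2 := by
  have h1 : ∀ x : ℝ, 0 ≤ (∫ s in r..q, g s ^ 2) * (x * x) + (2 * ∫ s in r..q, g s * h s) * x +
      ∫ s in r..q, h s ^ 2 := by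
    intro x
    have h2 : ∫ s in r..q, (x * g s + h s) ^ 2 = (∫ s in r..q, g s ^ 2) * (x * x) +
        (2 * ∫ s in r..q, g s * h s) * x + ∫ s in r..q, h s ^ 2 := by
      have : (fun s => (x * g s + h s) ^ 2) =
          fun s => g s ^ 2 * (x * x) + g s * h s * (2 * x) + h s ^ 2 := by
        ext s; ring
      rw [this, intervalIntegral.integral_add ((hg.mul_const _).add (hgh.mul_const _)) hh,
        intervalIntegral.integral_add (hg.mul_const _) (hgh.mul_const _),
        intervalIntegral.integral_mul_const, intervalIntegral.integral_mul_const]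
      ring
    rw [← h2]
    exact intervalIntegral.integral_nonneg hrq fun s _ => sq_nonneg _
  have h3 := discrim_le_zero h1
  rw [discrim] at h3
  nlinarith

/-- The heat kernel gains one derivative in `L²`-in-time. -/
theorem norm_sq_integral_exp_smul_le {f : ℝ → ℂ} (hf : LocBdd f) {μ : ℝ} (hμ : 0 ≤ μ) {r q : ℝ}
    (hrq : r ≤ q) :
    ‖∫ s in r..q, Real.exp (μ * s) • √μ • f s‖ ^ 2 ≤
      1 / 2 * Real.exp (2 * μ * q) * ∫ s in r..q, ‖f s‖ ^ 2 := by
  have hE : Continuous fun s : ℝ => Real.exp (μ * s) * √μ := by fun_prop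
  have h1 : ‖∫ s in r..q, Real.exp (μ * s) • √μ • f s‖ ≤
      ∫ s in r..q, (Real.exp (μ * s) * √μ) * ‖f s‖ := by
    refine (intervalIntegral.norm_integral_le_integral_norm hrq).trans (le_of_eq ?_)
    refine intervalIntegral.integral_congr fun s _ => ?_
    rw [smul_smul, norm_smul, Real.norm_of_nonneg (by positivity)]
  -- The weight `√μ` is the critical one: its square makes the integrand an exact derivative, so the
  -- constant `1 / 2` does not depend on `μ`.
  have h2 : ∫ s in r..q, (Real.exp (μ * s) * √μ) ^ 2 ≤ 1 / 2 * Real.exp (2 * μ * q) := by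
    have h3 : ∀ s : ℝ, HasDerivAt (fun s => 1 / 2 * Real.exp (2 * μ * s))
        ((Real.exp (μ * s) * √μ) ^ 2) s := by
      intro s
      have h4 := (((hasDerivAt_id s).const_mul (2 * μ)).exp).const_mul (1 / 2)
      refine h4.congr_deriv ?_
      rw [mul_pow, Real.sq_sqrt hμ, ← Real.exp_nat_mul]
      simp only [id]
      rw [show ((2 : ℕ) : ℝ) * (μ * s) = 2 * μ * s by push_cast; ring]
      ring
    rw [intervalIntegral.integral_eq_sub_of_hasDerivAt (fun s _ => h3 s)
      ((hE.pow 2).intervalIntegrable _ _)]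
    have := Real.exp_pos (2 * μ * r)
    linarith
  have h5 : IntervalIntegrable (fun s => ‖f s‖) volume r q := (hf.intervalIntegrable r q).norm
  calc ‖∫ s in r..q, Real.exp (μ * s) • √μ • f s‖ ^ 2
      ≤ (∫ s in r..q, (Real.exp (μ * s) * √μ) * ‖f s‖) ^ 2 := by gcongr
    _ ≤ (∫ s in r..q, (Real.exp (μ * s) * √μ) ^ 2) * ∫ s in r..q, ‖f s‖ ^ 2 :=
        sq_integral_mul_le hrq ((hE.pow 2).intervalIntegrable _ _)
          (h5.continuousOn_mul hE.continuousOn) (hf.intervalIntegrable_norm_sq _ _)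
    _ ≤ _ := by
        gcongr
        exact intervalIntegral.integral_nonneg hrq fun s _ => sq_nonneg _

/-- Grönwall's inequality in integral form. -/
theorem le_mul_exp_of_le_add_integral {f : ℝ → ℝ} (hf : Continuous f) {A K : ℝ} (hK : 0 ≤ K)
    (h : ∀ t, 0 ≤ t → f t ≤ A + K * ∫ s in (0 : ℝ)..t, f s) {t : ℝ} (ht : 0 ≤ t) :
    f t ≤ A * Real.exp (K * t) := by
  -- The majorant is differentiable with `g' = K f ≤ K g` on `[0, ∞)`, so `exp (-K t) g` decreases
  -- there.
  let g : ℝ → ℝ := fun t => A + K * ∫ s in (0 : ℝ)..t, f s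
  have hg : ∀ t, HasDerivAt g (K * f t) t := fun t =>
    ((intervalIntegral.integral_hasDerivAt_right (hf.intervalIntegrable _ _)
      hf.stronglyMeasurable.stronglyMeasurableAtFilter hf.continuousAt).const_mul K).const_add A
  have hG : ∀ t, HasDerivAt (fun t => Real.exp (-K * t) * g t)
      (Real.exp (-K * t) * (K * (f t - g t))) t := by
    intro t
    have h1 : HasDerivAt (fun t : ℝ => Real.exp (-K * t)) (Real.exp (-K * t) * (-K)) t := by
      simpa using ((hasDerivAt_id t).const_mul (-K)).exp
    refine (h1.mul (hg t)).congr_deriv ?_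
    ring
  have hanti : AntitoneOn (fun t => Real.exp (-K * t) * g t) (Set.Ici 0) := by
    refine antitoneOn_of_deriv_nonpos (convex_Ici 0)
      (fun t _ => (hG t).continuousAt.continuousWithinAt)
      (fun t _ => (hG t).differentiableAt.differentiableWithinAt) fun t ht => ?_
    rw [(hG t).deriv]
    rw [interior_Ici] at ht
    have h1 : f t - g t ≤ 0 := sub_nonpos.2 (h t (le_of_lt ht))
    exact mul_nonpos_of_nonneg_of_nonpos (Real.exp_pos _).le
      (mul_nonpos_of_nonneg_of_nonpos hK h1)
  have h1 := hanti Set.self_mem_Ici ht ht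
  simp only [g, mul_zero, Real.exp_zero, intervalIntegral.integral_same, add_zero, one_mul] at h1
  calc f t ≤ g t := h t ht
    _ = Real.exp (K * t) * (Real.exp (-K * t) * g t) := by
        rw [← mul_assoc, ← Real.exp_add]; simp
    _ ≤ Real.exp (K * t) * A := by gcongr
    _ = _ := mul_comm _ _

end Duhamel

/-! ### Square-summable families of modes -/

section Modes

variable {ι H : Type*} [NormedAddCommGroup H] [InnerProductSpace ℂ H] (e : HilbertBasis ι ℂ H)

theorem hasSum_norm_sq_repr (x : H) : HasSum (fun κ => ‖e.repr x κ‖ ^ 2) (‖x‖ ^ 2) := by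
  have h := lp.hasSum_norm (p := 2) (by norm_num) (e.repr x)
  simpa using h

theorem sum_norm_sq_repr_le (x : H) (S : Finset ι) : ∑ κ ∈ S, ‖e.repr x κ‖ ^ 2 ≤ ‖x‖ ^ 2 :=
  sum_le_hasSum S (fun _ _ => sq_nonneg _) (hasSum_norm_sq_repr e x)

theorem norm_sq_le_of_sum_norm_sq_repr_le {x : H} {C : ℝ}
    (h : ∀ S : Finset ι, ∑ κ ∈ S, ‖e.repr x κ‖ ^ 2 ≤ C) : ‖x‖ ^ 2 ≤ C :=
  hasSum_le_of_sum_le (hasSum_norm_sq_repr e x) h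

theorem exists_repr_eq {m : ι → ℂ} {C : ℝ} (h : ∀ S : Finset ι, ∑ κ ∈ S, ‖m κ‖ ^ 2 ≤ C) :
    ∃ x : H, ∀ κ, e.repr x κ = m κ := by
  have hm : Memℓp m 2 := memℓp_gen' (C := C) (by simpa using h)
  exact ⟨e.repr.symm ⟨m, hm⟩, fun κ => by simp⟩

theorem eq_of_repr_eq {x y : H} (h : ∀ κ, e.repr x κ = e.repr y κ) : x = y :=
  e.repr.injective (lp.ext (funext h))

theorem norm_sq_add_le_two_mul {E : Type*} [SeminormedAddCommGroup E] (x y : E) :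
    ‖x + y‖ ^ 2 ≤ 2 * ‖x‖ ^ 2 + 2 * ‖y‖ ^ 2 := by
  have h := norm_add_le x y
  nlinarith [sq_nonneg (‖x‖ - ‖y‖), norm_nonneg (x + y)]

/-- A curve with continuous modes that are locally uniformly square-summable is continuous. -/
theorem continuous_of_continuous_repr {Y : ℝ → H} (hY : ∀ κ, Continuous fun t => e.repr (Y t) κ)
    (hb : ∀ R : ℝ, ∃ β : ι → ℝ, Summable β ∧ ∀ t, |t| ≤ R → ∀ κ, ‖e.repr (Y t) κ‖ ^ 2 ≤ β κ) :
    Continuous Y := by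
  rw [continuous_iff_continuousAt]
  intro t₀
  obtain ⟨β, hβ, hβY⟩ := hb (|t₀| + 1)
  have h1 : Tendsto (fun t => ∑' κ, ‖e.repr (Y t - Y t₀) κ‖ ^ 2) (𝓝 t₀) (𝓝 (∑' _ : ι, (0 : ℝ))) := by
    -- Dominated convergence over the modes; the 4 comes from `‖a - b‖² ≤ 2 ‖a‖² + 2 ‖b‖²`, each
    -- term being bounded by `β`.
    refine tendsto_tsum_of_dominated_convergence (bound := fun κ => 4 * β κ) (hβ.mul_left 4) ?_ ?_
    · intro κ
      have h2 : Continuous fun t => ‖e.repr (Y t - Y t₀) κ‖ ^ 2 := by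
        simp only [map_sub, lp.coeFn_sub, Pi.sub_apply]
        exact (((hY κ).sub continuous_const).norm).pow 2
      simpa using h2.tendsto t₀
    · filter_upwards [Metric.ball_mem_nhds t₀ one_pos] with t ht κ
      rw [Metric.mem_ball, Real.dist_eq] at ht
      have h3 : |t| ≤ |t₀| + 1 := by
        have := abs_add_le (t - t₀) t₀
        rw [sub_add_cancel] at this
        linarith
      have h4 := norm_sq_add_le_two_mul (e.repr (Y t) κ) (-(e.repr (Y t₀) κ))
      rw [norm_neg] at h4
      simp only [map_sub, lp.coeFn_sub, Pi.sub_apply, norm_pow, norm_norm]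
      rw [sub_eq_add_neg]
      linarith [hβY t h3 κ, hβY t₀ (by linarith) κ]
  simp only [tsum_zero, (hasSum_norm_sq_repr e _).tsum_eq] at h1
  have h5 := h1.sqrt
  simp only [Real.sqrt_zero, Real.sqrt_sq (norm_nonneg _)] at h5
  exact tendsto_iff_norm_sub_tendsto_zero.2 h5

end Modes

/-! ### Diagonal parabolic systems with a rough first-order drift -/

section ModeSystem

variable {ι H : Type*} [NormedAddCommGroup H] [InnerProductSpace ℂ H]

/-- A measurable, uniformly bounded family of operators `H → ℓ²(ι)`, given by its coordinates. -/
structure IsDrift (a : ℝ → ι → H →L[ℂ] ℂ) (K : ℝ) : Prop where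
  nonneg : 0 ≤ K
  meas : ∀ κ x, StronglyMeasurable fun s => a s κ x
  bound : ∀ s x (S : Finset ι), ∑ κ ∈ S, ‖a s κ x‖ ^ 2 ≤ K * ‖x‖ ^ 2

namespace IsDrift

variable {a : ℝ → ι → H →L[ℂ] ℂ} {K : ℝ}

theorem shift (ha : IsDrift a K) (s₀ : ℝ) : IsDrift (fun s => a (s₀ + s)) K where
  nonneg := ha.nonneg
  meas κ x := (ha.meas κ x).comp_measurable (measurable_const_add s₀)
  bound s x S := ha.bound (s₀ + s) x S

/-- Carathéodory: continuity in `x` and measurability in `s` give joint measurability, which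
survives substituting `x = B s`. Second countability of `H` enters here. -/
theorem locBdd [SecondCountableTopology H] (ha : IsDrift a K) {B : ℝ → H} (hB : Continuous B)
    (κ : ι) : LocBdd fun s => a s κ (B s) where
  meas := by
    borelize H
    have h := stronglyMeasurable_uncurry_of_continuous_of_stronglyMeasurable
      (u := fun (x : H) (s : ℝ) => a s κ x) (fun s => (a s κ).continuous) (fun x => ha.meas κ x)
    exact h.comp_measurable (hB.measurable.prodMk measurable_id)
  bdd R := by
    obtain ⟨C, hC⟩ := (isCompact_Icc (a := -R) (b := R)).exists_bound_of_continuousOn hB.continuousOn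
    refine ⟨√K * C, fun s hs => ?_⟩
    have h1 := ha.bound s (B s) {κ}
    rw [Finset.sum_singleton] at h1
    have h2 : ‖a s κ (B s)‖ ≤ √K * ‖B s‖ := by
      rw [← Real.sqrt_sq (norm_nonneg (B s)), ← Real.sqrt_mul ha.nonneg]
      exact Real.le_sqrt_of_sq_le h1
    exact h2.trans (by gcongr; exact hC s (abs_le.1 hs))

theorem sum_integral_norm_sq_le [SecondCountableTopology H] (ha : IsDrift a K) {B : ℝ → H}
    (hB : Continuous B) (S : Finset ι) {r q : ℝ} (hrq : r ≤ q) :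
    ∑ κ ∈ S, ∫ s in r..q, ‖a s κ (B s)‖ ^ 2 ≤ K * ∫ s in r..q, ‖B s‖ ^ 2 := by
  rw [← intervalIntegral.integral_finsetSum
    fun κ _ => (ha.locBdd hB κ).intervalIntegrable_norm_sq r q, ← intervalIntegral.integral_const_mul]
  refine intervalIntegral.integral_mono_on hrq ?_ ?_ fun s _ => ha.bound s (B s) S
  · have := IntervalIntegrable.sum S fun κ _ => (ha.locBdd hB κ).intervalIntegrable_norm_sq r q
    rwa [Finset.sum_fn] at this
  · exact (continuous_const.mul (hB.norm.pow 2)).intervalIntegrable _ _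

end IsDrift

variable (e : HilbertBasis ι ℂ H) (lam : ι → ℝ) (a : ℝ → ι → H →L[ℂ] ℂ)

/-- `B` solves, on `[0, ∞)` and mode by mode, the integrated form of `c' = √λ a(s, B) - λ c`. -/
def IsModeSolution (B : ℝ → H) : Prop :=
  ∀ κ t, 0 ≤ t → e.repr (B t) κ = e.repr (B 0) κ +
    ∫ s in (0 : ℝ)..t, (√(lam κ) • a s κ (B s) - lam κ • e.repr (B s) κ)

/-- The mode `κ` at time `t` of the right-hand side of Duhamel's formula. -/
def duhamel (x : H) (B : ℝ → H) (κ : ι) (t : ℝ) : ℂ :=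
  Real.exp (-lam κ * t) • (e.repr x κ +
    ∫ s in (0 : ℝ)..t, Real.exp (lam κ * s) • √(lam κ) • a s κ (B s))

variable {e lam a} {K : ℝ}

theorem continuous_repr {B : ℝ → H} (hB : Continuous B) (κ : ι) :
    Continuous fun t => e.repr (B t) κ := by
  simp only [e.repr_apply_apply]
  fun_prop

theorem IsModeSolution.shift {B : ℝ → H} (h : IsModeSolution e lam a B)
    (ha : ∀ κ, LocBdd fun s => √(lam κ) • a s κ (B s) - lam κ • e.repr (B s) κ)
    {s₀ : ℝ} (hs₀ : 0 ≤ s₀) :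
    IsModeSolution e lam (fun s => a (s₀ + s)) (fun s => B (s₀ + s)) := by
  intro κ t ht
  change e.repr (B (s₀ + t)) κ = e.repr (B (s₀ + 0)) κ + ∫ s in (0 : ℝ)..t,
    (√(lam κ) • a (s₀ + s) κ (B (s₀ + s)) - lam κ • e.repr (B (s₀ + s)) κ)
  rw [add_zero s₀, h κ (s₀ + t) (by positivity), h κ s₀ hs₀, add_assoc,
    intervalIntegral.integral_comp_add_left
      (fun s => √(lam κ) • a s κ (B s) - lam κ • e.repr (B s) κ), add_zero s₀,
    intervalIntegral.integral_add_adjacent_intervals ((ha κ).intervalIntegrable _ _)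
      ((ha κ).intervalIntegrable _ _)]

/-- The growth `exp (2 λ t)` of the kernel estimate cancels against the square of the prefactor `exp
(-λ t)`, so the forcing enters with a constant independent of the mode. -/
theorem norm_sq_duhamel_le (hlam : ∀ κ, 0 ≤ lam κ) (x : H) {B : ℝ → H} {κ : ι}
    (hf : LocBdd fun s => a s κ (B s)) {t : ℝ} (ht : 0 ≤ t) :
    ‖duhamel e lam a x B κ t‖ ^ 2 ≤ 2 * Real.exp (-2 * lam κ * t) * ‖e.repr x κ‖ ^ 2 +
      ∫ s in (0 : ℝ)..t, ‖a s κ (B s)‖ ^ 2 := by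
  have h1 := norm_sq_integral_exp_smul_le hf (hlam κ) ht
  have h2 := norm_sq_add_le_two_mul (e.repr x κ)
    (∫ s in (0 : ℝ)..t, Real.exp (lam κ * s) • √(lam κ) • a s κ (B s))
  have h3 : Real.exp (-2 * lam κ * t) * Real.exp (2 * lam κ * t) = 1 := by
    rw [← Real.exp_add]; simp
  rw [duhamel, norm_smul, mul_pow, Real.norm_of_nonneg (Real.exp_pos _).le, ← Real.exp_nat_mul,
    show ((2 : ℕ) : ℝ) * (-lam κ * t) = -2 * lam κ * t by push_cast; ring]
  calc _ ≤ Real.exp (-2 * lam κ * t) * (2 * ‖e.repr x κ‖ ^ 2 + 2 *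
        (1 / 2 * Real.exp (2 * lam κ * t) * ∫ s in (0 : ℝ)..t, ‖a s κ (B s)‖ ^ 2)) := by
        gcongr
        linarith
    _ = 2 * Real.exp (-2 * lam κ * t) * ‖e.repr x κ‖ ^ 2 +
        Real.exp (-2 * lam κ * t) * Real.exp (2 * lam κ * t) *
          ∫ s in (0 : ℝ)..t, ‖a s κ (B s)‖ ^ 2 := by ring
    _ = _ := by rw [h3, one_mul]

variable [SecondCountableTopology H]

theorem IsDrift.locBdd_rhs (ha : IsDrift a K) {B : ℝ → H} (hB : Continuous B) (κ : ι) :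
    LocBdd fun s => √(lam κ) • a s κ (B s) - lam κ • e.repr (B s) κ :=
  ((ha.locBdd hB κ).smul continuous_const).sub
    ((LocBdd.of_continuous (continuous_repr hB κ)).smul continuous_const)

theorem isModeSolution_iff_duhamel (ha : IsDrift a K) {B : ℝ → H} (hB : Continuous B) :
    IsModeSolution e lam a B ↔
      ∀ κ t, 0 ≤ t → e.repr (B t) κ = duhamel e lam a (B 0) B κ t :=
  forall_congr' fun κ => eq_integral_iff_eq_duhamel
    ((ha.locBdd hB κ).smul (continuous_const (y := √(lam κ)))) (continuous_repr hB κ) (lam κ) _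

/-- Serves twice: `m = 0` yields the energy bound over all modes, and large `m` yields the damping
of high modes. -/
theorem sum_norm_sq_duhamel_le (ha : IsDrift a K) (hlam : ∀ κ, 0 ≤ lam κ) (x : H) {B : ℝ → H}
    (hB : Continuous B) {S : Finset ι} {m : ℝ} (hS : ∀ κ ∈ S, m ≤ lam κ) {t : ℝ} (ht : 0 ≤ t) :
    ∑ κ ∈ S, ‖duhamel e lam a x B κ t‖ ^ 2 ≤
      2 * Real.exp (-2 * m * t) * ‖x‖ ^ 2 + K * ∫ s in (0 : ℝ)..t, ‖B s‖ ^ 2 := by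
  calc ∑ κ ∈ S, ‖duhamel e lam a x B κ t‖ ^ 2
      ≤ ∑ κ ∈ S, (2 * Real.exp (-2 * m * t) * ‖e.repr x κ‖ ^ 2 +
          ∫ s in (0 : ℝ)..t, ‖a s κ (B s)‖ ^ 2) := by
        refine Finset.sum_le_sum fun κ hκ =>
          (norm_sq_duhamel_le hlam x (ha.locBdd hB κ) ht).trans ?_
        have h1 : -2 * lam κ * t ≤ -2 * m * t :=
          mul_le_mul_of_nonneg_right (by linarith [hS κ hκ]) ht
        gcongr
    _ ≤ _ := by
        rw [Finset.sum_add_distrib, ← Finset.mul_sum]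
        exact add_le_add (mul_le_mul_of_nonneg_left (sum_norm_sq_repr_le e x S) (by positivity))
          (ha.sum_integral_norm_sq_le hB S ht)

theorem duhamel_sub (ha : IsDrift a K) {B C : ℝ → H} (hB : Continuous B) (hC : Continuous C)
    (x y : H) (κ : ι) (t : ℝ) :
    duhamel e lam a x B κ t - duhamel e lam a y C κ t =
      duhamel e lam a (x - y) (fun s => B s - C s) κ t := by
  have hE : Continuous fun s : ℝ => Real.exp (lam κ * s) := by fun_prop
  have h1 := (((ha.locBdd hB κ).smul (continuous_const (y := √(lam κ)))).smul hE).intervalIntegrable 0 t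
  have h2 := (((ha.locBdd hC κ).smul (continuous_const (y := √(lam κ)))).smul hE).intervalIntegrable 0 t
  simp only [duhamel, ← smul_sub, map_sub, lp.coeFn_sub, Pi.sub_apply]
  have h3 : ∫ s in (0 : ℝ)..t, Real.exp (lam κ * s) • √(lam κ) • (a s κ (B s) - a s κ (C s)) =
      (∫ s in (0 : ℝ)..t, Real.exp (lam κ * s) • √(lam κ) • a s κ (B s)) -
        ∫ s in (0 : ℝ)..t, Real.exp (lam κ * s) • √(lam κ) • a s κ (C s) := by
    rw [← intervalIntegral.integral_sub h1 h2]
    simp only [smul_sub]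
  rw [h3]
  congr 1
  ring

theorem continuous_duhamel (ha : IsDrift a K) {B : ℝ → H} (hB : Continuous B) (x : H) (κ : ι) :
    Continuous (duhamel e lam a x B κ) := by
  have hE : Continuous fun s : ℝ => Real.exp (lam κ * s) := by fun_prop
  have h1 : Continuous fun t => ∫ s in (0 : ℝ)..t, Real.exp (lam κ * s) • √(lam κ) • a s κ (B s) :=
    intervalIntegral.continuous_primitive (fun r q =>
      (((ha.locBdd hB κ).smul (continuous_const (y := √(lam κ)))).smul hE).intervalIntegrable r q) 0
  unfold duhamel
  fun_prop

theorem norm_sq_le_of_repr_eq_duhamel (ha : IsDrift a K) (hlam : ∀ κ, 0 ≤ lam κ) {x y : H}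
    {B : ℝ → H} (hB : Continuous B) {t : ℝ} (ht : 0 ≤ t)
    (hy : ∀ κ, e.repr y κ = duhamel e lam a x B κ t) :
    ‖y‖ ^ 2 ≤ 2 * ‖x‖ ^ 2 + K * ∫ s in (0 : ℝ)..t, ‖B s‖ ^ 2 := by
  refine norm_sq_le_of_sum_norm_sq_repr_le e fun S => ?_
  simp only [hy]
  have := sum_norm_sq_duhamel_le (e := e) ha hlam x hB (S := S) (m := 0) (fun κ _ => hlam κ) ht
  simpa using this

/-- The Duhamel map: the right-hand side of Duhamel's formula is a continuous curve. -/
theorem exists_continuous_repr_eq_duhamel (ha : IsDrift a K) (hlam : ∀ κ, 0 ≤ lam κ) (x : H)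
    {B : ℝ → H} (hB : Continuous B) :
    ∃ Y : ℝ → H, Continuous Y ∧ ∀ t κ, e.repr (Y t) κ = duhamel e lam a x B κ (max t 0) := by
  -- Clamping time at 0 gives a curve on all of ℝ, so that continuity needs no restriction to a
  -- half-line.
  choose Y hY using fun t : ℝ => exists_repr_eq e (m := fun κ => duhamel e lam a x B κ (max t 0))
    (fun S => sum_norm_sq_duhamel_le (e := e) ha hlam x hB (S := S) (m := 0)
      (fun κ _ => hlam κ) (le_max_right t 0))
  refine ⟨Y, continuous_of_continuous_repr e ?_ ?_, hY⟩
  · intro κ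
    simp only [hY]
    exact (continuous_duhamel ha hB x κ).comp (by fun_prop)
  · intro R
    refine ⟨fun κ => 2 * ‖e.repr x κ‖ ^ 2 + ∫ s in (0 : ℝ)..|R|, ‖a s κ (B s)‖ ^ 2, ?_, ?_⟩
    · refine ((hasSum_norm_sq_repr e x).summable.mul_left 2).add
        (summable_of_sum_le (fun κ => ?_) fun S => ha.sum_integral_norm_sq_le hB S (abs_nonneg R))
      exact intervalIntegral.integral_nonneg (abs_nonneg R) fun s _ => sq_nonneg _
    · intro t ht κ
      rw [hY]
      refine (norm_sq_duhamel_le hlam x (ha.locBdd hB κ) (le_max_right t 0)).trans ?_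
      have h1 : Real.exp (-2 * lam κ * max t 0) ≤ 1 := by
        rw [Real.exp_le_one_iff]
        have := mul_nonneg (hlam κ) (le_max_right t 0)
        linarith
      have h2 : max t 0 ≤ |R| :=
        max_le ((le_abs_self t).trans (ht.trans (le_abs_self R))) (abs_nonneg R)
      have h3 : ∫ s in (0 : ℝ)..(max t 0), ‖a s κ (B s)‖ ^ 2 ≤
          ∫ s in (0 : ℝ)..|R|, ‖a s κ (B s)‖ ^ 2 :=
        intervalIntegral.integral_mono_interval le_rfl (le_max_right t 0) h2
          (Eventually.of_forall fun s => sq_nonneg _) ((ha.locBdd hB κ).intervalIntegrable_norm_sq _ _)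
      have h4 : Real.exp (-2 * lam κ * max t 0) * ‖e.repr x κ‖ ^ 2 ≤ 1 * ‖e.repr x κ‖ ^ 2 := by
        gcongr
      linarith

open scoped BoundedContinuousFunction in
theorem exists_isModeSolution [CompleteSpace H] (ha : IsDrift a K) (hlam : ∀ κ, 0 ≤ lam κ) (x : H) :
    ∃ B : ℝ → H, Continuous B ∧ B 0 = x ∧ IsModeSolution e lam a B := by
  have hK := ha.nonneg
  -- growing curves are described by bounded ones, with weight `e ^ (μ t)`
  let μ : ℝ := K + 1
  have hμ : 0 < μ := by positivity
  let F : (ℝ →ᵇ H) → ℝ → H := fun G s => Real.exp (μ * max s 0) • G s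
  have hF : ∀ G, Continuous (F G) := fun G => by
    have := G.continuous
    fun_prop
  choose Y hYc hY using fun G => exists_continuous_repr_eq_duhamel (e := e) ha hlam x (hF G)
  have hexp : ∀ t : ℝ, 0 ≤ t → ∫ s in (0 : ℝ)..t, Real.exp (2 * μ * s) ≤
      1 / (2 * μ) * Real.exp (2 * μ * t) := by
    intro t ht
    have h3 : ∀ s : ℝ, HasDerivAt (fun s => 1 / (2 * μ) * Real.exp (2 * μ * s))
        (Real.exp (2 * μ * s)) s := by
      intro s
      have h4 := (((hasDerivAt_id s).const_mul (2 * μ)).exp).const_mul (1 / (2 * μ))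
      refine h4.congr_deriv ?_
      simp only [id]
      field_simp
    rw [intervalIntegral.integral_eq_sub_of_hasDerivAt (fun s _ => h3 s)
      ((by fun_prop : Continuous fun s : ℝ => Real.exp (2 * μ * s)).intervalIntegrable _ _)]
    have : 0 ≤ 1 / (2 * μ) * Real.exp (2 * μ * 0) := by positivity
    linarith
  have hint : ∀ (f : ℝ → H) (D : ℝ), Continuous f →
      (∀ s, 0 ≤ s → ‖f s‖ ≤ Real.exp (μ * s) * D) → ∀ t : ℝ, 0 ≤ t →
      ∫ s in (0 : ℝ)..t, ‖f s‖ ^ 2 ≤ D ^ 2 / (2 * μ) * Real.exp (2 * μ * t) := by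
    intro f D hf hfD t ht
    calc ∫ s in (0 : ℝ)..t, ‖f s‖ ^ 2 ≤ ∫ s in (0 : ℝ)..t, D ^ 2 * Real.exp (2 * μ * s) := by
          refine intervalIntegral.integral_mono_on ht ((hf.norm.pow 2).intervalIntegrable _ _)
            ((by fun_prop : Continuous fun s : ℝ => D ^ 2 * Real.exp (2 * μ * s)).intervalIntegrable
              _ _) fun s hs => ?_
          refine (pow_le_pow_left₀ (norm_nonneg _) (hfD s hs.1) 2).trans (le_of_eq ?_)
          rw [mul_pow, ← Real.exp_nat_mul, mul_comm]
          congr 2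
          push_cast
          ring
      _ ≤ D ^ 2 * (1 / (2 * μ) * Real.exp (2 * μ * t)) := by
          rw [intervalIntegral.integral_const_mul]
          exact mul_le_mul_of_nonneg_left (hexp t ht) (sq_nonneg _)
      _ = _ := by ring
  have hsq : ∀ t : ℝ, Real.exp (2 * μ * t) = Real.exp (μ * t) ^ 2 := fun t => by
    rw [← Real.exp_nat_mul]; congr 1; push_cast; ring
  -- The weight turns the squared Lipschitz constant of the Duhamel map into `K / (2 μ)`. With `μ =
  -- K + 1` it is at most `1 / 2 < (3 / 4) ^ 2`, whence the ratio `3 / 4` below.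
  have hKμ : K / (2 * μ) ≤ 1 / 2 := by
    rw [div_le_div_iff₀ (by positivity) two_pos]
    simp only [μ]; linarith
  have hbd : ∀ G t, ‖Real.exp (-μ * max t 0) • Y G t‖ ≤ √(2 * ‖x‖ ^ 2 + ‖G‖ ^ 2) := by
    intro G t
    set t' := max t 0 with ht'
    have h0 : 0 ≤ t' := le_max_right t 0
    have h1 := norm_sq_le_of_repr_eq_duhamel ha hlam (hF G) h0 (hY G t)
    have h2 := hint (F G) ‖G‖ (hF G) (fun s hs => by
      simp only [F]
      rw [norm_smul, max_eq_left hs, Real.norm_of_nonneg (Real.exp_pos _).le]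
      gcongr
      exact G.norm_coe_le_norm s) t' h0
    have h3 : K * (‖G‖ ^ 2 / (2 * μ) * Real.exp (2 * μ * t')) ≤ ‖G‖ ^ 2 * Real.exp (μ * t') ^ 2 := by
      rw [← hsq]
      calc _ = K / (2 * μ) * (‖G‖ ^ 2 * Real.exp (2 * μ * t')) := by ring
        _ ≤ 1 * (‖G‖ ^ 2 * Real.exp (2 * μ * t')) := by gcongr; linarith
        _ = _ := one_mul _
    have h4 : 1 ≤ Real.exp (μ * t') := Real.one_le_exp (by positivity)
    have h5 : 2 * ‖x‖ ^ 2 ≤ 2 * ‖x‖ ^ 2 * Real.exp (μ * t') ^ 2 :=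
      le_mul_of_one_le_right (by positivity) (one_le_pow₀ h4)
    have h6 : K * ∫ s in (0 : ℝ)..t', ‖F G s‖ ^ 2 ≤
        K * (‖G‖ ^ 2 / (2 * μ) * Real.exp (2 * μ * t')) := mul_le_mul_of_nonneg_left h2 hK
    refine Real.le_sqrt_of_sq_le ?_
    rw [norm_smul, Real.norm_of_nonneg (Real.exp_pos _).le, neg_mul, Real.exp_neg, mul_pow, inv_pow,
      inv_mul_le_iff₀ (by positivity)]
    linarith
  let Ψ : (ℝ →ᵇ H) → (ℝ →ᵇ H) := fun G => BoundedContinuousFunction.ofNormedAddCommGroup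
    (fun t => Real.exp (-μ * max t 0) • Y G t)
    ((by fun_prop : Continuous fun t : ℝ => Real.exp (-μ * max t 0)).smul (hYc G)) _ (hbd G)
  have hΨ : ContractingWith (3 / 4) Ψ := by
    refine ⟨by rw [div_lt_one (by norm_num)]; norm_num, LipschitzWith.of_dist_le_mul fun G G' => ?_⟩
    rw [BoundedContinuousFunction.dist_le (by positivity)]
    intro t
    set t' := max t 0 with ht'
    have h0 : 0 ≤ t' := le_max_right t 0
    have h1 := norm_sq_le_of_repr_eq_duhamel (e := e) (x := 0) (y := Y G t - Y G' t)
      (B := fun s => F G s - F G' s) ha hlam ((hF G).sub (hF G')) h0 (fun κ => by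
        have := duhamel_sub (e := e) (lam := lam) ha (hF G) (hF G') x x κ t'
        rw [map_sub, lp.coeFn_sub, Pi.sub_apply, hY, hY, this, sub_self])
    have h2 := hint (fun s => F G s - F G' s) (dist G G') ((hF G).sub (hF G')) (fun s hs => by
      simp only [F]
      rw [← smul_sub, norm_smul, max_eq_left hs, Real.norm_of_nonneg (Real.exp_pos _).le,
        ← dist_eq_norm]
      gcongr
      exact BoundedContinuousFunction.dist_coe_le_dist s) t' h0
    have h3 : K * ((dist G G') ^ 2 / (2 * μ) * Real.exp (2 * μ * t')) ≤
        1 / 2 * ((dist G G') ^ 2 * Real.exp (μ * t') ^ 2) := by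
      rw [← hsq]
      calc _ = K / (2 * μ) * ((dist G G') ^ 2 * Real.exp (2 * μ * t')) := by ring
        _ ≤ _ := by gcongr
    have h6 : K * ∫ s in (0 : ℝ)..t', ‖F G s - F G' s‖ ^ 2 ≤
        K * ((dist G G') ^ 2 / (2 * μ) * Real.exp (2 * μ * t')) := mul_le_mul_of_nonneg_left h2 hK
    have h7 : ‖Y G t - Y G' t‖ ^ 2 ≤ (3 / 4 * dist G G' * Real.exp (μ * t')) ^ 2 := by
      have h8 : 0 ≤ (dist G G') ^ 2 * Real.exp (μ * t') ^ 2 := by positivity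
      simp only [norm_zero] at h1
      nlinarith
    have h9 := le_of_sq_le_sq h7 (by positivity)
    change dist (Real.exp (-μ * t') • Y G t) (Real.exp (-μ * t') • Y G' t) ≤ _
    rw [dist_eq_norm, ← smul_sub, norm_smul, Real.norm_of_nonneg (Real.exp_pos _).le, neg_mul,
      Real.exp_neg, inv_mul_le_iff₀ (Real.exp_pos _), mul_comm]
    exact h9
  obtain ⟨G, hG⟩ : ∃ G, Ψ G = G := ⟨_, hΨ.fixedPoint_isFixedPt⟩
  -- Removing the weight from the fixed point: the curve fed into Duhamel's formula is the one it
  -- produces.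
  have hFY : F G = Y G := by
    funext s
    have h1 : G s = Real.exp (-μ * max s 0) • Y G s := by
      conv_lhs => rw [← hG]
      rfl
    simp only [F]
    rw [h1, smul_smul, ← Real.exp_add]
    simp
  have h0 : Y G 0 = x := eq_of_repr_eq e fun κ => by
    rw [hY, max_self, duhamel]
    simp
  refine ⟨Y G, hYc G, h0, (isModeSolution_iff_duhamel ha (hYc G)).2 fun κ t ht => ?_⟩
  rw [h0, hY, max_eq_left ht, hFY]

namespace IsModeSolution

theorem add_smul (ha : IsDrift a K) {B C : ℝ → H} (hB : Continuous B) (hC : Continuous C)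
    (h : IsModeSolution e lam a B) (h' : IsModeSolution e lam a C) (z : ℂ) :
    IsModeSolution e lam a (fun t => B t + z • C t) := by
  intro κ t ht
  have h1 := (ha.locBdd_rhs (e := e) (lam := lam) hB κ).intervalIntegrable 0 t
  have h2 := (ha.locBdd_rhs (e := e) (lam := lam) hC κ).intervalIntegrable 0 t
  have h3 : ∫ s in (0 : ℝ)..t, (√(lam κ) • (a s κ (B s) + z * a s κ (C s)) -
      lam κ • (e.repr (B s) κ + z * e.repr (C s) κ)) =
      (∫ s in (0 : ℝ)..t, (√(lam κ) • a s κ (B s) - lam κ • e.repr (B s) κ)) +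
        z * ∫ s in (0 : ℝ)..t, (√(lam κ) • a s κ (C s) - lam κ • e.repr (C s) κ) := by
    rw [← intervalIntegral.integral_const_mul, ← intervalIntegral.integral_add h1 (h2.const_mul z)]
    refine intervalIntegral.integral_congr fun s _ => ?_
    simp only [Complex.real_smul]
    ring
  simp only [map_add, map_smul, lp.coeFn_add, lp.coeFn_smul, Pi.add_apply, Pi.smul_apply,
    smul_eq_mul]
  rw [h3, h κ t ht, h' κ t ht]
  ring

/-- Grönwall for the Duhamel energy bound. By linearity it also yields uniqueness, applied to a
difference of solutions. -/
theorem norm_sq_le (ha : IsDrift a K) (hlam : ∀ κ, 0 ≤ lam κ) {B : ℝ → H} (hB : Continuous B)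
    (h : IsModeSolution e lam a B) {t : ℝ} (ht : 0 ≤ t) :
    ‖B t‖ ^ 2 ≤ 2 * ‖B 0‖ ^ 2 * Real.exp (K * t) :=
  le_mul_exp_of_le_add_integral (f := fun t => ‖B t‖ ^ 2) (hB.norm.pow 2) ha.nonneg
    (fun t ht => norm_sq_le_of_repr_eq_duhamel ha hlam hB ht fun κ =>
      (isModeSolution_iff_duhamel ha hB).1 h κ t ht) ht

theorem norm_sq_le_of_le (ha : IsDrift a K) (hlam : ∀ κ, 0 ≤ lam κ) {B : ℝ → H}
    (hB : Continuous B) (h : IsModeSolution e lam a B) {s t : ℝ} (hs : 0 ≤ s) (hst : s ≤ t) :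
    ‖B t‖ ^ 2 ≤ 2 * ‖B s‖ ^ 2 * Real.exp (K * (t - s)) := by
  have h1 := norm_sq_le (ha.shift s) hlam (hB.comp (continuous_const_add s))
    (h.shift (fun κ => ha.locBdd_rhs hB κ) hs) (sub_nonneg.2 hst)
  simpa using h1

theorem eq_of_apply_zero_eq (ha : IsDrift a K) (hlam : ∀ κ, 0 ≤ lam κ) {B C : ℝ → H}
    (hB : Continuous B) (hC : Continuous C) (h : IsModeSolution e lam a B)
    (h' : IsModeSolution e lam a C) (h0 : B 0 = C 0) {t : ℝ} (ht : 0 ≤ t) : B t = C t := by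
  have h1 := norm_sq_le ha hlam (hB.add (hC.const_smul (-1 : ℂ)))
    (add_smul ha hB hC h h' (-1)) ht
  simp only [neg_smul, one_smul, Pi.add_apply] at h1
  have h2 : ‖B t + -C t‖ = 0 := by
    have h3 : ‖B t + -C t‖ ^ 2 = 0 := le_antisymm (by simpa [h0] using h1) (sq_nonneg _)
    exact pow_eq_zero_iff two_ne_zero |>.1 h3
  rwa [norm_eq_zero, ← sub_eq_add_neg, sub_eq_zero] at h2

/-- Smoothing: over a short time `δ`, the high modes become small. -/
theorem sum_norm_sq_repr_le (ha : IsDrift a K) (hlam : ∀ κ, 0 ≤ lam κ) {B : ℝ → H}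
    (hB : Continuous B) (h : IsModeSolution e lam a B) {S : Finset ι} {m : ℝ}
    (hS : ∀ κ ∈ S, m ≤ lam κ) {δ : ℝ} (hδ : 0 ≤ δ) {t : ℝ} (hδt : δ ≤ t) :
    ∑ κ ∈ S, ‖e.repr (B t) κ‖ ^ 2 ≤
      4 * Real.exp (K * t) * (Real.exp (-2 * m * δ) + K * δ) * ‖B 0‖ ^ 2 := by
  have hK := ha.nonneg
  have hr : 0 ≤ t - δ := sub_nonneg.2 hδt
  have hBr : Continuous fun s => B (t - δ + s) := hB.comp (continuous_const_add _)
  -- Restart at `t - δ`: over the last interval the modes with `λ ≥ m` lose a factor `exp (-2 m δ)`,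
  -- and the forcing contributes only `K δ`.
  have h1 := (isModeSolution_iff_duhamel (ha.shift (t - δ)) hBr).1
    (h.shift (fun κ => ha.locBdd_rhs hB κ) hr)
  have h2 := sum_norm_sq_duhamel_le (e := e) (ha.shift (t - δ)) hlam (B (t - δ + 0)) hBr hS hδ
  rw [Finset.sum_congr rfl fun κ _ => by rw [← h1 κ δ hδ], sub_add_cancel, add_zero] at h2
  have hgrow : ∀ s, 0 ≤ s → s ≤ t → ‖B s‖ ^ 2 ≤ 2 * ‖B 0‖ ^ 2 * Real.exp (K * t) := by
    intro s hs hst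
    refine (norm_sq_le ha hlam hB h hs).trans ?_
    gcongr
  have h3 : ∫ s in (0 : ℝ)..δ, ‖B (t - δ + s)‖ ^ 2 ≤ δ * (2 * ‖B 0‖ ^ 2 * Real.exp (K * t)) := by
    calc ∫ s in (0 : ℝ)..δ, ‖B (t - δ + s)‖ ^ 2
        ≤ ∫ _ in (0 : ℝ)..δ, 2 * ‖B 0‖ ^ 2 * Real.exp (K * t) := by
          refine intervalIntegral.integral_mono_on hδ ((hBr.norm.pow 2).intervalIntegrable _ _)
            (by simp) fun s hs => hgrow _ (add_nonneg hr hs.1) (by linarith [hs.2])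
      _ = _ := by rw [intervalIntegral.integral_const, smul_eq_mul, sub_zero]
  refine h2.trans ?_
  calc 2 * Real.exp (-2 * m * δ) * ‖B (t - δ)‖ ^ 2 + K * ∫ s in (0 : ℝ)..δ, ‖B (t - δ + s)‖ ^ 2
      ≤ 2 * Real.exp (-2 * m * δ) * (2 * ‖B 0‖ ^ 2 * Real.exp (K * t)) +
        K * (δ * (2 * ‖B 0‖ ^ 2 * Real.exp (K * t))) := by
        gcongr
        exact hgrow _ hr (by linarith)
    _ ≤ 2 * Real.exp (-2 * m * δ) * (2 * ‖B 0‖ ^ 2 * Real.exp (K * t)) +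
        2 * (K * (δ * (2 * ‖B 0‖ ^ 2 * Real.exp (K * t)))) := by
        have : 0 ≤ K * (δ * (2 * ‖B 0‖ ^ 2 * Real.exp (K * t))) := by positivity
        linarith
    _ = _ := by ring

end IsModeSolution

omit [SecondCountableTopology H] in
/-- An operator into `H` whose high modes are uniformly small is compact. -/
theorem isCompactOperator_of_sum_norm_sq_repr_le [CompleteSpace H] {V : Type*}
    [NormedAddCommGroup V] [NormedSpace ℂ V] (e : HilbertBasis ι ℂ H) {T : V →L[ℂ] H}
    (hT : ∀ η > 0, ∃ S₀ : Finset ι, ∀ S : Finset ι, Disjoint S S₀ → ∀ x,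
      ∑ κ ∈ S, ‖e.repr (T x) κ‖ ^ 2 ≤ η * ‖x‖ ^ 2) : IsCompactOperator T := by
  classical
  -- Orthogonal projections onto finitely many modes. Each `P S ∘L T` is compact, and the hypothesis
  -- says that they converge to `T` in operator norm.
  let P : Finset ι → H →L[ℂ] H := fun S =>
    ∑ κ ∈ S, (innerSL ℂ (e κ)).smulRight (e κ)
  have hP : ∀ S x κ, e.repr (P S x) κ = if κ ∈ S then e.repr x κ else 0 := by
    intro S x κ
    simp only [P, sum_apply, ContinuousLinearMap.smulRight_apply,
      innerSL_apply_apply, ← e.repr_apply_apply]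
    rw [e.repr_apply_apply, inner_sum]
    simp only [inner_smul_right, orthonormal_iff_ite.1 e.orthonormal, mul_ite, mul_one, mul_zero]
    rw [Finset.sum_ite_eq]
  have hPc : ∀ S, IsCompactOperator (P S ∘L T) := by
    intro S
    have h1 : ∀ κ, IsCompactOperator ((innerSL ℂ (e κ)).smulRight (e κ) ∘L T : V →L[ℂ] H) := by
      intro κ
      have h2 := (isCompactOperator_of_locallyCompactSpace_rng
        (ContinuousLinearMap.toSpanSingleton ℂ (e κ))).comp_clm ((innerSL ℂ (e κ)) ∘L T)
      exact h2
    have h3 : P S ∘L T ∈ compactOperator (RingHom.id ℂ) V H := by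
      have : P S ∘L T = ∑ κ ∈ S, ((innerSL ℂ (e κ)).smulRight (e κ) ∘L T) := by
        ext x; simp [P]
      rw [this]
      exact Submodule.sum_mem _ fun κ _ => h1 κ
    exact h3
  refine isCompactOperator_of_tendsto (l := atTop) (F := fun S : Finset ι => P S ∘L T) ?_
    (Eventually.of_forall hPc)
  rw [Metric.tendsto_atTop]
  intro r hr
  obtain ⟨S₀, hS₀⟩ := hT ((r / 2) ^ 2) (by positivity)
  refine ⟨S₀, fun S hS => ?_⟩
  rw [dist_eq_norm]
  refine lt_of_le_of_lt (ContinuousLinearMap.opNorm_le_bound _ (half_pos hr).le fun x => ?_)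
    (half_lt_self hr)
  refine le_of_sq_le_sq ?_ (by positivity)
  refine norm_sq_le_of_sum_norm_sq_repr_le e fun S' => ?_
  have h1 : ∀ κ, ‖e.repr ((P S ∘L T - T) x) κ‖ ^ 2 = if κ ∉ S then ‖e.repr (T x) κ‖ ^ 2 else 0 := by
    intro κ
    have : e.repr ((P S ∘L T - T) x) κ = e.repr (P S (T x)) κ - e.repr (T x) κ := by
      simp
    rw [this, hP]
    split_ifs <;> simp
  simp only [h1]
  rw [← Finset.sum_filter, mul_pow]
  refine hS₀ _ ?_ x
  rw [Finset.disjoint_left]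
  intro κ hκ hκ'
  exact (Finset.mem_filter.1 hκ).2 (hS hκ')

end ModeSystem

open UnitAddTorus

/-! ### Calculus of test functions -/

theorem IsTest.continuous {φ : T3 → ℂ} (hφ : IsTest φ) : Continuous φ := by
  rw [isOpenQuotientMap_toT3.isQuotientMap.continuous_iff]
  exact ContDiff.continuous (𝕜 := ℝ) (n := ∞) hφ

theorem IsTest.partialDeriv {φ : T3 → ℂ} (hφ : IsTest φ) (j : Fin 3) :
    IsTest (partialDeriv j φ) := by
  have h1 : (fun y : Fin 3 → ℝ => KinematicDynamo.partialDeriv j φ (fun i => (y i : UnitAddCircle))) =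
      fun y => fderiv ℝ (fun y => φ (toT3 y)) y (Pi.single j 1) :=
    funext fun y => partialDeriv_toT3 j hφ y
  unfold IsTest
  rw [h1]
  have h2 : ContDiff ℝ ∞ (fun y => φ (toT3 y)) := hφ
  exact (h2.fderiv_right (m := ∞) (by simp)).clm_apply contDiff_const

theorem IsTest.hasDerivAt {φ : T3 → ℂ} (hφ : IsTest φ) (j : Fin 3) (x : T3) (s : ℝ) :
    HasDerivAt (fun s : ℝ => φ (x + Pi.single j (s : UnitAddCircle)))
      (KinematicDynamo.partialDeriv j φ (x + Pi.single j (s : UnitAddCircle))) s := by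
  obtain ⟨y, hy⟩ := isOpenQuotientMap_toT3.surjective x
  have h0 : ∀ s : ℝ, x + Pi.single j (s : UnitAddCircle) = toT3 (y + s • Pi.single j 1) := by
    intro s
    rw [← hy]
    funext i
    by_cases h : i = j
    · subst h; simp [toT3]
    · simp [toT3, h]
  rw [h0, partialDeriv_toT3 j hφ]
  have h1 : HasFDerivAt (fun y => φ (toT3 y)) (fderiv ℝ (fun y => φ (toT3 y))
      (y + s • Pi.single j 1)) (y + s • Pi.single j 1) :=
    ((show ContDiff ℝ ∞ (fun y => φ (toT3 y)) from hφ).differentiable (by simp) _).hasFDerivAt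
  have h2 : HasDerivAt (fun s : ℝ => y + s • (Pi.single j 1 : Fin 3 → ℝ)) (Pi.single j 1) s := by
    simpa using ((hasDerivAt_id s).smul_const (Pi.single j 1 : Fin 3 → ℝ)).const_add y
  have h3 := h1.comp_hasDerivAt s h2
  refine h3.congr_of_eventuallyEq (Eventually.of_forall fun s => ?_)
  simp only [h0, Function.comp]

theorem IsTest.mul {φ ψ : T3 → ℂ} (hφ : IsTest φ) (hψ : IsTest ψ) :
    IsTest (fun x => φ x * ψ x) :=
  ContDiff.mul hφ hψ

theorem partialDeriv_mul {φ ψ : T3 → ℂ} (hφ : IsTest φ) (hψ : IsTest ψ) (j : Fin 3) (x : T3) :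
    partialDeriv j (fun x => φ x * ψ x) x =
      partialDeriv j φ x * ψ x + φ x * partialDeriv j ψ x := by
  have h := ((hφ.hasDerivAt j x 0).fun_mul (hψ.hasDerivAt j x 0)).deriv
  refine h.trans ?_
  simp

theorem integrable_of_continuous {φ : T3 → ℂ} (hφ : Continuous φ) :
    Integrable φ (volume : Measure T3) :=
  hφ.integrable_of_hasCompactSupport (HasCompactSupport.of_compactSpace φ)

theorem continuous_translate {φ : T3 → ℂ} (hφ : Continuous φ) (j : Fin 3) (s : ℝ) :
    Continuous fun x : T3 => φ (x + Pi.single j (s : UnitAddCircle)) :=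
  hφ.comp (continuous_add_const _)

/-- By invariance of Haar measure the integral of a translate of `φ` does not depend on the shift;
differentiate under the integral at shift 0. -/
theorem integral_partialDeriv {φ : T3 → ℂ} (hφ : IsTest φ) (j : Fin 3) :
    ∫ x : T3, partialDeriv j φ x = 0 := by
  have hc := continuous_partialDeriv j hφ
  obtain ⟨C, hC⟩ := isCompact_univ.exists_bound_of_continuousOn hc.continuousOn
  let F : ℝ → T3 → ℂ := fun s x => φ (x + Pi.single j (s : UnitAddCircle))
  let F' : ℝ → T3 → ℂ := fun s x => partialDeriv j φ (x + Pi.single j (s : UnitAddCircle))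
  have hF : ∀ s, Continuous (F s) := fun s => continuous_translate hφ.continuous j s
  have hF' : ∀ s, Continuous (F' s) := fun s => continuous_translate hc j s
  have hb : Integrable (fun _ : T3 => C) (volume : Measure T3) := integrable_const C
  have h1 : HasDerivAt (fun s => ∫ x : T3, F s x) (∫ x : T3, F' 0 x) 0 :=
    (hasDerivAt_integral_of_dominated_loc_of_deriv_le (F := F) (F' := F') (x₀ := (0 : ℝ))
      (bound := fun _ => C) univ_mem
      (Eventually.of_forall fun s => (hF s).aestronglyMeasurable)
      (integrable_of_continuous (hF 0)) (hF' 0).aestronglyMeasurable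
      (Eventually.of_forall fun x s _ => hC _ (Set.mem_univ _)) hb
      (Eventually.of_forall fun x s _ => hφ.hasDerivAt j x s)).2
  have h2 : ∀ s, ∫ x : T3, F s x = ∫ x : T3, φ x :=
    fun s => integral_add_right_eq_self φ _
  simp only [h2] at h1
  have h3 := h1.unique (hasDerivAt_const (0 : ℝ) (∫ x : T3, φ x))
  simpa [F'] using h3

theorem mFourier_apply_add (k : Fin 3 → ℤ) (x y : T3) :
    mFourier k (x + y) = mFourier k x * mFourier k y := by
  simp only [mFourier, ContinuousMap.coe_mk, ← Finset.prod_mul_distrib]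
  refine Finset.prod_congr rfl fun i _ => ?_
  simp [fourier_apply, smul_add, AddCircle.toCircle_add]

theorem mFourier_apply_single (k : Fin 3 → ℤ) (j : Fin 3) (z : UnitAddCircle) :
    mFourier k (Pi.single j z) = fourier (k j) z := by
  simp only [mFourier, ContinuousMap.coe_mk]
  rw [Finset.prod_eq_single j]
  · simp
  · intro i _ hi
    simp [Pi.single_eq_of_ne hi]
  · simp

theorem isTest_mFourier (k : Fin 3 → ℤ) : IsTest (mFourier k) := by
  unfold IsTest
  simp only [mFourier, ContinuousMap.coe_mk]
  refine contDiff_prod fun i _ => ?_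
  simp only [fourier_coe_apply]
  refine ContDiff.cexp ?_
  have : ContDiff ℝ ∞ fun y : Fin 3 → ℝ => ((y i : ℝ) : ℂ) :=
    Complex.ofRealCLM.contDiff.comp (contDiff_apply ℝ ℝ i)
  exact (contDiff_const.mul this).div_const _

theorem partialDeriv_mFourier (k : Fin 3 → ℤ) (j : Fin 3) (x : T3) :
    partialDeriv j (mFourier k) x = 2 * Real.pi * Complex.I * k j * mFourier k x := by
  unfold partialDeriv
  simp only [mFourier_apply_add, mFourier_apply_single]
  have h := ((hasDerivAt_fourier 1 (k j) 0).const_mul (mFourier k x)).deriv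
  refine h.trans ?_
  simp
  ring

theorem partialDeriv_const_mul {φ : T3 → ℂ} (hφ : IsTest φ) (c : ℂ) (j : Fin 3) (x : T3) :
    partialDeriv j (fun x => c * φ x) x = c * partialDeriv j φ x := by
  refine ((hφ.hasDerivAt j x 0).const_mul c).deriv.trans ?_
  simp

/-- The Fourier coefficients of a function on the torus. -/
def coeff (f : T3 → ℂ) (k : Fin 3 → ℤ) : ℂ := ∫ x : T3, mFourier (-k) x * f x

/-- Integration by parts: the derivative of the product with `mFourier (-k)` integrates to 0. -/
theorem coeff_partialDeriv {φ : T3 → ℂ} (hφ : IsTest φ) (j : Fin 3) (k : Fin 3 → ℤ) :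
    coeff (partialDeriv j φ) k = 2 * Real.pi * Complex.I * k j * coeff φ k := by
  have h1 := integral_partialDeriv ((isTest_mFourier (-k)).mul hφ) j
  simp only [partialDeriv_mul (isTest_mFourier (-k)) hφ, partialDeriv_mFourier] at h1
  have hF : Continuous (mFourier (-k) : T3 → ℂ) := (mFourier (-k)).continuous
  have hd := continuous_partialDeriv j hφ
  have hc := hφ.continuous
  rw [integral_add (integrable_of_continuous (by fun_prop))
    (integrable_of_continuous (by fun_prop))] at h1
  simp only [coeff]
  rw [eq_neg_of_add_eq_zero_right h1, ← integral_const_mul, ← integral_neg]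
  congr 1
  ext x
  simp only [Pi.neg_apply]
  push_cast
  ring

/-! ### Fourier series on the torus -/

/-- The Hilbert space `L²(𝕋³; ℂ)`. -/
abbrev L2s : Type := Lp ℂ 2 (volume : Measure T3)

instance : IsProbabilityMeasure (volume : Measure UnitAddCircle) :=
  ⟨by rw [UnitAddCircle.measure_univ]⟩

instance : IsProbabilityMeasure (volume : Measure T3) :=
  inferInstanceAs (IsProbabilityMeasure (Measure.pi fun _ : Fin 3 => (volume : Measure UnitAddCircle)))

/-- The monomial `e^{2πi k·x}` as an element of `L²`. -/
def monomialLp (k : Fin 3 → ℤ) : L2s := ContinuousMap.toLp 2 volume ℂ (mFourier k : C(T3, ℂ))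

theorem coeFn_monomialLp (k : Fin 3 → ℤ) : monomialLp k =ᵐ[volume] mFourier k :=
  ContinuousMap.coeFn_toLp volume _

theorem inner_monomialLp (k : Fin 3 → ℤ) (F : L2s) : inner ℂ (monomialLp k) F = coeff F k := by
  rw [L2.inner_def, coeff]
  refine integral_congr_ae ?_
  filter_upwards [coeFn_monomialLp k] with x hx
  rw [hx, RCLike.inner_apply, mFourier_neg, mul_comm]

/-- For `k ≠ 0` some partial derivative of the monomial is a nonzero multiple of it, and derivatives
have zero mean. -/
theorem integral_mFourier (k : Fin 3 → ℤ) : ∫ x : T3, mFourier k x = if k = 0 then 1 else 0 := by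
  split_ifs with h
  · subst h
    simp [mFourier_zero]
  · obtain ⟨j, hj⟩ := Function.ne_iff.1 h
    have h1 := integral_partialDeriv (isTest_mFourier k) j
    simp only [partialDeriv_mFourier] at h1
    rw [integral_const_mul] at h1
    refine (mul_eq_zero.1 h1).resolve_left ?_
    simpa [Real.pi_ne_zero] using hj

theorem coeff_mFourier (k l : Fin 3 → ℤ) : coeff (mFourier l) k = if k = l then 1 else 0 := by
  unfold coeff
  simp only [← mFourier_add]
  rw [integral_mFourier]
  simp only [neg_add_eq_zero]

theorem coeff_congr {f g : T3 → ℂ} (h : f =ᵐ[volume] g) (k : Fin 3 → ℤ) :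
    coeff f k = coeff g k :=
  integral_congr_ae (h.mono fun x hx => by simp only [hx])

theorem coeff_monomialLp (k l : Fin 3 → ℤ) : coeff (monomialLp l) k = if k = l then 1 else 0 := by
  rw [coeff_congr (coeFn_monomialLp l), coeff_mFourier]

theorem orthonormal_monomialLp : Orthonormal ℂ monomialLp := by
  rw [orthonormal_iff_ite]
  intro k l
  rw [inner_monomialLp, coeff_monomialLp]

theorem span_monomialLp_closure_eq_top :
    (Submodule.span ℂ (Set.range monomialLp)).topologicalClosure = ⊤ := by
  have h := (ContinuousMap.toLp_denseRange ℂ (volume : Measure T3) ℂ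
    (p := 2) (by norm_num)).topologicalClosure_map_submodule
      (span_mFourier_closure_eq_top (d := Fin 3))
  simpa only [Submodule.map_span, ContinuousLinearMap.coe_coe, ← Set.range_comp] using! h

/-- The Fourier basis of `L²(𝕋³; ℂ)`. -/
def scalarBasis : HilbertBasis (Fin 3 → ℤ) ℂ L2s :=
  HilbertBasis.mk orthonormal_monomialLp span_monomialLp_closure_eq_top.ge

theorem scalarBasis_repr (F : L2s) (k : Fin 3 → ℤ) : scalarBasis.repr F k = coeff F k := by
  rw [HilbertBasis.repr_apply_apply, ← inner_monomialLp, scalarBasis, HilbertBasis.coe_mk]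

/-- The `i`-th component of a square-integrable field. -/
def comp (i : Fin 3) : L2 →L[ℂ] L2s :=
  (EuclideanSpace.proj i : EuclideanSpace ℂ (Fin 3) →L[ℂ] ℂ).compLpL 2 volume

theorem coeFn_comp (i : Fin 3) (B : L2) : comp i B =ᵐ[volume] fun x => B x i :=
  ContinuousLinearMap.coeFn_compLpL _ B

theorem norm_comp_le (i : Fin 3) (B : L2) : ‖comp i B‖ ≤ ‖B‖ := by
  refine Lp.norm_le_norm_of_ae_le ?_
  filter_upwards [coeFn_comp i B] with x hx
  rw [hx]
  exact PiLp.norm_apply_le (B x) i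

theorem ext_comp {A B : L2} (h : ∀ i, comp i A = comp i B) : A = B := by
  refine Lp.ext ?_
  have h1 : ∀ᵐ x : T3, ∀ i, A x i = B x i := by
    rw [ae_all_iff]
    intro i
    filter_upwards [coeFn_comp i A, coeFn_comp i B] with x h1 h2
    rw [← h1, ← h2, h i]
  filter_upwards [h1] with x hx
  ext i
  exact hx i

/-- The vector-valued monomial `e^{2πi k·x} eᵢ`. -/
def vectorMonomial (κ : (Fin 3 → ℤ) × Fin 3) : L2 :=
  ContinuousMap.toLp (E := EuclideanSpace ℂ (Fin 3)) 2 volume ℂ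
    ⟨fun x => mFourier κ.1 x • EuclideanSpace.single κ.2 (1 : ℂ), by fun_prop⟩

theorem coeFn_vectorMonomial (κ : (Fin 3 → ℤ) × Fin 3) :
    vectorMonomial κ =ᵐ[volume] fun x => mFourier κ.1 x • EuclideanSpace.single κ.2 (1 : ℂ) :=
  ContinuousMap.coeFn_toLp volume _

theorem inner_vectorMonomial (κ : (Fin 3 → ℤ) × Fin 3) (B : L2) :
    inner ℂ (vectorMonomial κ) B = coeff (comp κ.2 B) κ.1 := by
  rw [L2.inner_def, coeff]
  refine integral_congr_ae ?_
  filter_upwards [coeFn_vectorMonomial κ, coeFn_comp κ.2 B] with x h1 h2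
  rw [h1, h2, inner_smul_left, EuclideanSpace.inner_single_left, mFourier_neg]
  simp

theorem comp_vectorMonomial (κ : (Fin 3 → ℤ) × Fin 3) (i : Fin 3) :
    comp i (vectorMonomial κ) = if κ.2 = i then monomialLp κ.1 else 0 := by
  refine Lp.ext ?_
  split_ifs with h
  · filter_upwards [coeFn_vectorMonomial κ, coeFn_comp i (vectorMonomial κ),
      coeFn_monomialLp κ.1] with x h1 h2 h3
    rw [h2, h1, h3]
    simp [h]
  · filter_upwards [coeFn_vectorMonomial κ, coeFn_comp i (vectorMonomial κ),
      Lp.coeFn_zero ℂ 2 (volume : Measure T3)] with x h1 h2 h3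
    rw [h2, h1, h3]
    simp [Ne.symm h]

theorem coeff_zero_Lp (k : Fin 3 → ℤ) : coeff (0 : L2s) k = 0 := by
  rw [← inner_monomialLp, inner_zero_right]

theorem orthonormal_vectorMonomial : Orthonormal ℂ vectorMonomial := by
  rw [orthonormal_iff_ite]
  rintro ⟨k, i⟩ ⟨l, j⟩
  rw [inner_vectorMonomial, comp_vectorMonomial]
  by_cases h : j = i
  · subst h
    simp [coeff_monomialLp]
  · rw [if_neg h, if_neg (by simp [Ne.symm h]), coeff_zero_Lp]

/-- The Fourier basis of `L²(𝕋³; ℂ³)`. -/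
def fieldBasis : HilbertBasis ((Fin 3 → ℤ) × Fin 3) ℂ L2 :=
  HilbertBasis.mkOfOrthogonalEqBot orthonormal_vectorMonomial (by
    rw [Submodule.eq_bot_iff]
    intro B hB
    refine ext_comp fun i => ?_
    rw [map_zero]
    refine scalarBasis.repr.injective (lp.ext (funext fun k => ?_))
    rw [scalarBasis_repr, map_zero, lp.coeFn_zero, Pi.zero_apply,
      ← inner_vectorMonomial (k, i) B]
    exact (Submodule.mem_orthogonal _ _).1 hB _ (Submodule.subset_span ⟨(k, i), rfl⟩))

theorem fieldBasis_repr (B : L2) (κ : (Fin 3 → ℤ) × Fin 3) :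
    fieldBasis.repr B κ = coeff (comp κ.2 B) κ.1 := by
  rw [HilbertBasis.repr_apply_apply, ← inner_vectorMonomial, fieldBasis,
    HilbertBasis.coe_mkOfOrthogonalEqBot]

/-- The Fourier basis is countable. This serves the joint measurability in `IsDrift.locBdd`. -/
instance : SecondCountableTopology L2 := by
  have h1 : TopologicalSpace.IsSeparable (Set.univ : Set L2) := by
    have h2 := ((Set.countable_range fieldBasis).isSeparable.span (R := ℂ)).closure
    have h3 := congrArg (fun V : Submodule ℂ L2 => (V : Set L2)) fieldBasis.dense_span
    rw [Submodule.topologicalClosure_coe, Submodule.top_coe] at h3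
    rwa [h3] at h2
  have : TopologicalSpace.SeparableSpace L2 := TopologicalSpace.isSeparable_univ_iff.1 h1
  exact UniformSpace.secondCountable_of_separable L2

/-- A test function as an element of `L²`. -/
def testLp {φ : T3 → ℂ} (hφ : IsTest φ) : L2s :=
  ContinuousMap.toLp 2 volume ℂ (⟨φ, hφ.continuous⟩ : C(T3, ℂ))

theorem coeFn_testLp {φ : T3 → ℂ} (hφ : IsTest φ) : testLp hφ =ᵐ[volume] φ :=
  ContinuousMap.coeFn_toLp volume _

theorem hasSum_testLp {φ : T3 → ℂ} (hφ : IsTest φ) :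
    HasSum (fun k => coeff φ k • monomialLp k) (testLp hφ) := by
  have h := scalarBasis.hasSum_repr (testLp hφ)
  refine h.congr_fun fun k => ?_
  rw [scalarBasis_repr, coeff_congr (coeFn_testLp hφ), scalarBasis, HilbertBasis.coe_mk]

/-- The bilinear pairing of `L²` with itself. -/
def pairing (F : L2s) : L2s →L[ℂ] ℂ := innerSL ℂ (star F)

theorem pairing_eq_integral (F G : L2s) : pairing F G = ∫ x : T3, F x * G x := by
  rw [pairing, innerSL_apply_apply, L2.inner_def]
  refine integral_congr_ae ?_
  filter_upwards [Lp.coeFn_star F] with x hx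
  rw [hx]
  simp [mul_comm]

theorem norm_pairing_le (F G : L2s) : ‖pairing F G‖ ≤ ‖F‖ * ‖G‖ := by
  have h : ‖star F‖ ≤ ‖F‖ := by
    refine Lp.norm_le_norm_of_ae_le ?_
    filter_upwards [Lp.coeFn_star F] with x hx
    rw [hx, Pi.star_apply, norm_star]
  exact (norm_inner_le_norm (𝕜 := ℂ) (star F) G).trans (mul_le_mul_of_nonneg_right h (norm_nonneg G))

theorem pairing_testLp (F : L2s) {φ : T3 → ℂ} (hφ : IsTest φ) :
    pairing F (testLp hφ) = ∫ x : T3, F x * φ x := by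
  rw [pairing_eq_integral]
  refine integral_congr_ae ?_
  filter_upwards [coeFn_testLp hφ] with x hx
  rw [hx]

theorem pairing_monomialLp (F : L2s) (k : Fin 3 → ℤ) :
    pairing F (monomialLp k) = coeff F (-k) := by
  rw [pairing_eq_integral, coeff]
  refine integral_congr_ae ?_
  filter_upwards [coeFn_monomialLp k] with x hx
  rw [hx, neg_neg, mul_comm]

theorem integrable_Lp_mul (F : L2s) {g : T3 → ℂ} (hg : Continuous g) :
    Integrable (fun x => F x * g x) (volume : Measure T3) := by
  obtain ⟨C, hC⟩ := isCompact_univ.exists_bound_of_continuousOn hg.continuousOn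
  exact ((Lp.memLp F).integrable (by norm_num)).mul_bdd hg.aestronglyMeasurable
    (Eventually.of_forall fun x => hC x (Set.mem_univ x))

/-! ### Solenoidal fields in Fourier space -/

theorem hasSum_pairing_partialDeriv (F : L2s) {φ : T3 → ℂ} (hφ : IsTest φ) (j : Fin 3) :
    HasSum (fun k : Fin 3 → ℤ => coeff φ k *
      (2 * Real.pi * Complex.I * k j * coeff F (-k)))
      (∫ x : T3, F x * partialDeriv j φ x) := by
  have h := (hasSum_testLp (hφ.partialDeriv j)).mapL (pairing F)
  rw [pairing_testLp] at h
  refine h.congr_fun fun k => ?_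
  rw [map_smul, pairing_monomialLp, coeff_partialDeriv hφ, smul_eq_mul]
  ring

theorem integral_sum_mul_partialDeriv (B : L2) {φ : T3 → ℂ} (hφ : IsTest φ) :
    ∫ x : T3, ∑ j : Fin 3, B x j * partialDeriv j φ x =
      ∑ j, ∫ x : T3, comp j B x * partialDeriv j φ x := by
  rw [integral_finsetSum _ fun j _ => integrable_mul_partialDeriv B j hφ]
  refine Finset.sum_congr rfl fun j _ => integral_congr_ae ?_
  filter_upwards [coeFn_comp j B] with x hx
  rw [hx]

/-- The condition `k · B̂(k) = 0`. Testing with `mFourier (-k)` gives one direction; expanding an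
arbitrary test function in its Fourier series gives the other. -/
theorem mem_L2div_iff (B : L2) :
    B ∈ L2div ↔ ∀ k : Fin 3 → ℤ, ∑ j, (k j : ℂ) * fieldBasis.repr B (k, j) = 0 := by
  simp only [fieldBasis_repr]
  constructor
  · intro h k
    have h1 := h _ (isTest_mFourier (-k))
    rw [integral_sum_mul_partialDeriv B (isTest_mFourier (-k))] at h1
    have h2 : ∀ j, ∫ x : T3, comp j B x * partialDeriv j (mFourier (-k)) x =
        -(2 * Real.pi * Complex.I) * (k j * coeff (comp j B) k) := by
      intro j
      simp only [partialDeriv_mFourier, coeff]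
      rw [← integral_const_mul, ← integral_const_mul]
      congr 1
      ext x
      simp only [Pi.neg_apply]
      push_cast
      ring
    simp only [h2, ← Finset.mul_sum] at h1
    exact (mul_eq_zero.1 h1).resolve_left (by simp [Real.pi_ne_zero])
  · intro h φ hφ
    rw [integral_sum_mul_partialDeriv B hφ]
    have h1 := hasSum_sum fun j (_ : j ∈ (Finset.univ : Finset (Fin 3))) =>
      hasSum_pairing_partialDeriv (comp j B) hφ j
    refine h1.unique ((hasSum_zero).congr_fun fun k => ?_)
    have h2 := h (-k)
    simp only [Pi.neg_apply] at h2
    have h3 : ∑ j, coeff φ k *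
        (2 * Real.pi * Complex.I * k j * coeff (comp j B) (-k)) =
        -(coeff φ k * (2 * Real.pi * Complex.I)) *
          ∑ j, ((-k j : ℤ) : ℂ) * coeff (comp j B) (-k) := by
      rw [Finset.mul_sum]
      refine Finset.sum_congr rfl fun j _ => ?_
      push_cast
      ring
    rw [h3, h2, mul_zero]

theorem isClosed_L2div : IsClosed (L2div : Set L2) := by
  have : (L2div : Set L2) = ⋂ k : Fin 3 → ℤ,
      {B | ∑ j, (k j : ℂ) * fieldBasis.repr B (k, j) = 0} := by
    ext B
    simp [mem_L2div_iff]
  rw [this]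
  refine isClosed_iInter fun k => isClosed_eq ?_ continuous_const
  simp only [HilbertBasis.repr_apply_apply]
  fun_prop

instance : CompleteSpace L2div := isClosed_L2div.completeSpace_coe

/-- A constant field is solenoidal. Nontriviality makes the spectrum of the monodromy operator
nonempty and provides a nonzero datum. -/
instance : Nontrivial L2div := by
  refine ⟨⟨⟨vectorMonomial (0, 0), ?_⟩, 0, fun h => ?_⟩⟩
  · rw [mem_L2div_iff]
    intro k
    rcases eq_or_ne k 0 with rfl | hk
    · simp
    · simp only [fieldBasis_repr, comp_vectorMonomial]
      refine Finset.sum_eq_zero fun j _ => ?_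
      split_ifs
      · rw [coeff_monomialLp, if_neg hk, mul_zero]
      · rw [coeff_zero_Lp, mul_zero]
  · have := congrArg Subtype.val h
    exact orthonormal_vectorMonomial.ne_zero (0, 0) this

/-! ### The induction operator in Fourier space -/

/-- A bounded jointly measurable velocity field. -/
structure BoundedVelocity where
  toFun : ℝ → T3 → EuclideanSpace ℝ (Fin 3)
  bd : ℝ
  meas : StronglyMeasurable (Function.uncurry toFun)
  bound : ∀ s x, ‖toFun s x‖ ≤ bd

namespace BoundedVelocity

variable (v : BoundedVelocity)

theorem bd_nonneg : 0 ≤ v.bd := (norm_nonneg _).trans (v.bound 0 0)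

theorem stronglyMeasurable_coord (j : Fin 3) :
    StronglyMeasurable fun p : ℝ × T3 => ((v.toFun p.1 p.2 j : ℝ) : ℂ) := by
  have h : Continuous fun w : EuclideanSpace ℝ (Fin 3) => ((w j : ℝ) : ℂ) := by fun_prop
  exact h.comp_stronglyMeasurable v.meas

theorem norm_coord_le (j : Fin 3) (s : ℝ) (x : T3) : ‖((v.toFun s x j : ℝ) : ℂ)‖ ≤ v.bd := by
  rw [Complex.norm_real]
  exact (PiLp.norm_apply_le (v.toFun s x) j).trans (v.bound s x)

theorem memLp_coord_mul (j : Fin 3) (s : ℝ) (F : L2s) :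
    MemLp (fun x => ((v.toFun s x j : ℝ) : ℂ) * F x) 2 (volume : Measure T3) := by
  refine (Lp.memLp F).of_le_mul (c := v.bd) ?_ (Eventually.of_forall fun x => ?_)
  · exact ((v.stronglyMeasurable_coord j).comp_measurable
      measurable_prodMk_left).aestronglyMeasurable.mul (Lp.aestronglyMeasurable F)
  · rw [norm_mul]
    exact mul_le_mul_of_nonneg_right (v.norm_coord_le j s x) (norm_nonneg _)

/-- Multiplication by the `j`-th component of the velocity at time `s`. -/
def mulCoord (j : Fin 3) (s : ℝ) : L2s →L[ℂ] L2s :=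
  LinearMap.mkContinuous
    { toFun := fun F => (v.memLp_coord_mul j s F).toLp
      map_add' := fun F G => by
        refine Lp.ext ?_
        filter_upwards [(v.memLp_coord_mul j s (F + G)).coeFn_toLp,
          (v.memLp_coord_mul j s F).coeFn_toLp, (v.memLp_coord_mul j s G).coeFn_toLp,
          Lp.coeFn_add F G, Lp.coeFn_add (v.memLp_coord_mul j s F).toLp
            (v.memLp_coord_mul j s G).toLp] with x h1 h2 h3 h4 h5
        rw [h1, h5, Pi.add_apply, h2, h3, h4, Pi.add_apply, mul_add]
      map_smul' := fun c F => by
        refine Lp.ext ?_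
        filter_upwards [(v.memLp_coord_mul j s (c • F)).coeFn_toLp,
          (v.memLp_coord_mul j s F).coeFn_toLp, Lp.coeFn_smul c F,
          Lp.coeFn_smul c (v.memLp_coord_mul j s F).toLp] with x h1 h2 h3 h4
        rw [h1, RingHom.id_apply, h4, Pi.smul_apply, h2, h3, Pi.smul_apply, smul_eq_mul,
          smul_eq_mul, mul_left_comm] }
    v.bd fun F => by
      refine Lp.norm_le_mul_norm_of_ae_le_mul ?_
      filter_upwards [(v.memLp_coord_mul j s F).coeFn_toLp] with x hx
      change ‖((v.memLp_coord_mul j s F).toLp _ : L2s) x‖ ≤ _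
      rw [hx, norm_mul]
      exact mul_le_mul_of_nonneg_right (v.norm_coord_le j s x) (norm_nonneg _)

theorem coeFn_mulCoord (j : Fin 3) (s : ℝ) (F : L2s) :
    v.mulCoord j s F =ᵐ[volume] fun x => ((v.toFun s x j : ℝ) : ℂ) * F x :=
  (v.memLp_coord_mul j s F).coeFn_toLp

theorem norm_mulCoord_le (j : Fin 3) (s : ℝ) (F : L2s) : ‖v.mulCoord j s F‖ ≤ v.bd * ‖F‖ :=
  ContinuousLinearMap.le_of_opNorm_le _ (LinearMap.mkContinuous_norm_le _ v.bd_nonneg _) F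

/-- The antisymmetric flux `u_j B_i - u_i B_j`. -/
def flux (s : ℝ) (i j : Fin 3) : L2 →L[ℂ] L2s :=
  v.mulCoord j s ∘L comp i - v.mulCoord i s ∘L comp j

theorem coeFn_flux (s : ℝ) (i j : Fin 3) (B : L2) :
    v.flux s i j B =ᵐ[volume]
      fun x => ((v.toFun s x j : ℝ) : ℂ) * B x i - ((v.toFun s x i : ℝ) : ℂ) * B x j := by
  filter_upwards [Lp.coeFn_sub (v.mulCoord j s (comp i B)) (v.mulCoord i s (comp j B)),
    v.coeFn_mulCoord j s (comp i B), v.coeFn_mulCoord i s (comp j B), coeFn_comp i B,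
    coeFn_comp j B] with x h1 h2 h3 h4 h5
  rw [← h4, ← h5, ← h2, ← h3]
  exact h1

theorem norm_flux_le (s : ℝ) (i j : Fin 3) (B : L2) : ‖v.flux s i j B‖ ≤ 2 * v.bd * ‖B‖ := by
  have h : ∀ i j, ‖v.mulCoord j s (comp i B)‖ ≤ v.bd * ‖B‖ := fun i j =>
    (v.norm_mulCoord_le j s _).trans
      (mul_le_mul_of_nonneg_left (norm_comp_le i B) v.bd_nonneg)
  calc ‖v.flux s i j B‖ ≤ ‖v.mulCoord j s (comp i B)‖ + ‖v.mulCoord i s (comp j B)‖ :=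
        norm_sub_le _ _
    _ ≤ _ := by linarith [h i j, h j i]

theorem flux_swap (s : ℝ) (i j : Fin 3) (B : L2) : v.flux s j i B = -v.flux s i j B := by
  simp [flux]

theorem flux_congr {s s' : ℝ} (h : v.toFun s =ᵐ[volume] v.toFun s') (i j : Fin 3) (B : L2) :
    v.flux s i j B = v.flux s' i j B := by
  refine Lp.ext ?_
  filter_upwards [v.coeFn_flux s i j B, v.coeFn_flux s' i j B, h] with x h1 h2 h3
  rw [h1, h2, h3]

theorem stronglyMeasurable_coeff_flux (i j : Fin 3) (B : L2) (k : Fin 3 → ℤ) :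
    StronglyMeasurable fun s => coeff (v.flux s i j B) k := by
  have h1 : ∀ s, coeff (v.flux s i j B) k = ∫ x : T3, mFourier (-k) x *
      (((v.toFun s x j : ℝ) : ℂ) * B x i - ((v.toFun s x i : ℝ) : ℂ) * B x j) :=
    fun s => coeff_congr (v.coeFn_flux s i j B) k
  simp only [h1]
  have h2 : ∀ i, StronglyMeasurable fun p : ℝ × T3 => B p.2 i := by
    intro i
    have h3 : Continuous fun w : EuclideanSpace ℂ (Fin 3) => w i := by fun_prop
    exact (h3.comp_stronglyMeasurable (Lp.stronglyMeasurable B)).comp_measurable measurable_snd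
  refine StronglyMeasurable.integral_prod_right (f := fun s x => mFourier (-k) x *
      (((v.toFun s x j : ℝ) : ℂ) * B x i - ((v.toFun s x i : ℝ) : ℂ) * B x j)) ?_
  exact ((mFourier (-k)).continuous.stronglyMeasurable.comp_measurable measurable_snd).mul
    (((v.stronglyMeasurable_coord j).mul (h2 i)).sub ((v.stronglyMeasurable_coord i).mul (h2 j)))

end BoundedVelocity

/-- The eigenvalues of `-ε Δ`. -/
def heatRate (ε : ℝ) (κ : (Fin 3 → ℤ) × Fin 3) : ℝ :=
  4 * Real.pi ^ 2 * ε * ∑ j, (κ.1 j : ℝ) ^ 2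

theorem heatRate_nonneg {ε : ℝ} (hε : 0 ≤ ε) (κ : (Fin 3 → ℤ) × Fin 3) : 0 ≤ heatRate ε κ := by
  unfold heatRate
  positivity

theorem heatRate_eq_zero {ε : ℝ} (hε : 0 < ε) {κ : (Fin 3 → ℤ) × Fin 3} (h : heatRate ε κ = 0)
    (j : Fin 3) : κ.1 j = 0 := by
  unfold heatRate at h
  have h1 : ∑ j, (κ.1 j : ℝ) ^ 2 = 0 :=
    (mul_eq_zero.1 h).resolve_left (by have := Real.pi_pos; positivity)
  have h2 := (Finset.sum_eq_zero_iff_of_nonneg fun j _ => sq_nonneg (κ.1 j : ℝ)).1 h1 j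
    (Finset.mem_univ j)
  simpa using h2

/-- The Fourier coefficients of `(-ε Δ)^{-1/2} ∇ · (flux)`. -/
def drift (v : BoundedVelocity) (ε s : ℝ) (κ : (Fin 3 → ℤ) × Fin 3) : L2 →L[ℂ] ℂ :=
  ((√(heatRate ε κ))⁻¹ : ℂ) • ∑ j, (-(2 * Real.pi * Complex.I * κ.1 j) : ℂ) •
    (innerSL ℂ (monomialLp κ.1) ∘L v.flux s κ.2 j)

theorem drift_apply (v : BoundedVelocity) (ε s : ℝ) (κ : (Fin 3 → ℤ) × Fin 3) (B : L2) :
    drift v ε s κ B = ((√(heatRate ε κ))⁻¹ : ℂ) *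
      ∑ j, -(2 * Real.pi * Complex.I * κ.1 j) * coeff (v.flux s κ.2 j B) κ.1 := by
  simp [drift, inner_monomialLp]

/-- Dividing by `√λ` loses nothing: `λ = 0` only for `k = 0`, where the convention `0⁻¹ = 0` is
harmless because the sum vanishes as well. -/
theorem sqrt_smul_drift (v : BoundedVelocity) {ε : ℝ} (hε : 0 < ε) (s : ℝ)
    (κ : (Fin 3 → ℤ) × Fin 3) (B : L2) :
    √(heatRate ε κ) • drift v ε s κ B =
      ∑ j, -(2 * Real.pi * Complex.I * κ.1 j) * coeff (v.flux s κ.2 j B) κ.1 := by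
  rw [drift_apply, Complex.real_smul]
  rcases (heatRate_nonneg hε.le κ).eq_or_lt with h | h
  · rw [← h]
    simp [heatRate_eq_zero hε h.symm]
  · rw [mul_inv_cancel_left₀]
    exact_mod_cast (Real.sqrt_pos.2 h).ne'

/-- Cauchy–Schwarz in `j` produces `4 π² |k|² = λ / ε`, and division by `λ` leaves `ε⁻¹` uniformly
in `k`. -/
theorem norm_sq_drift_le (v : BoundedVelocity) {ε : ℝ} (hε : 0 < ε) (s : ℝ)
    (κ : (Fin 3 → ℤ) × Fin 3) (B : L2) :
    ‖drift v ε s κ B‖ ^ 2 ≤ ε⁻¹ * ∑ j, ‖coeff (v.flux s κ.2 j B) κ.1‖ ^ 2 := by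
  have h1 : ‖∑ j, -(2 * Real.pi * Complex.I * κ.1 j) * coeff (v.flux s κ.2 j B) κ.1‖ ^ 2 ≤
      4 * Real.pi ^ 2 * (∑ j, (κ.1 j : ℝ) ^ 2) * ∑ j, ‖coeff (v.flux s κ.2 j B) κ.1‖ ^ 2 := by
    have h2 : ‖∑ j, -(2 * Real.pi * Complex.I * κ.1 j) * coeff (v.flux s κ.2 j B) κ.1‖ ≤
        2 * Real.pi * ∑ j, |(κ.1 j : ℝ)| * ‖coeff (v.flux s κ.2 j B) κ.1‖ := by
      refine (norm_sum_le _ _).trans (le_of_eq ?_)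
      rw [Finset.mul_sum]
      refine Finset.sum_congr rfl fun j _ => ?_
      rw [norm_mul, norm_neg, norm_mul, norm_mul, norm_mul, Complex.norm_I, Complex.norm_real,
        Real.norm_of_nonneg Real.pi_pos.le, Complex.norm_intCast]
      simp only [Complex.norm_ofNat]
      ring
    have h3 := Finset.sum_mul_sq_le_sq_mul_sq Finset.univ (fun j => |(κ.1 j : ℝ)|)
      (fun j => ‖coeff (v.flux s κ.2 j B) κ.1‖)
    simp only [sq_abs] at h3
    calc _ ≤ (2 * Real.pi * ∑ j, |(κ.1 j : ℝ)| * ‖coeff (v.flux s κ.2 j B) κ.1‖) ^ 2 := by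
          gcongr
      _ = 4 * Real.pi ^ 2 * (∑ j, |(κ.1 j : ℝ)| * ‖coeff (v.flux s κ.2 j B) κ.1‖) ^ 2 := by ring
      _ ≤ 4 * Real.pi ^ 2 * ((∑ j, (κ.1 j : ℝ) ^ 2) *
          ∑ j, ‖coeff (v.flux s κ.2 j B) κ.1‖ ^ 2) := by gcongr
      _ = _ := by ring
  rw [drift_apply, norm_mul, mul_pow, norm_inv, Complex.norm_real,
    Real.norm_of_nonneg (Real.sqrt_nonneg _), inv_pow, Real.sq_sqrt (heatRate_nonneg hε.le κ)]
  rcases (heatRate_nonneg hε.le κ).eq_or_lt with h | h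
  · rw [← h, inv_zero, zero_mul]
    positivity
  · rw [inv_mul_le_iff₀ h]
    refine h1.trans (le_of_eq ?_)
    unfold heatRate
    field_simp

/-- Bessel's inequality for each of the nine fluxes, of norm at most `2 * v.bd * ‖B‖`; hence 36 = 9
· 2². -/
theorem isDrift_drift (v : BoundedVelocity) {ε : ℝ} (hε : 0 < ε) :
    IsDrift (drift v ε) (ε⁻¹ * (36 * v.bd ^ 2)) where
  nonneg := by positivity
  meas κ B := by
    simp only [drift_apply]
    refine StronglyMeasurable.const_mul ?_ _
    refine Finset.stronglyMeasurable_fun_sum _ fun j _ => ?_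
    exact (v.stronglyMeasurable_coeff_flux κ.2 j B κ.1).const_mul _
  bound s B S := by
    classical
    let c : (Fin 3 → ℤ) × Fin 3 → ℝ := fun κ => ∑ j, ‖coeff (v.flux s κ.2 j B) κ.1‖ ^ 2
    have hc : ∀ κ, 0 ≤ c κ := fun κ => by positivity
    have h1 : ∑ κ ∈ S, c κ ≤ ∑ κ ∈ S.image Prod.fst ×ˢ (Finset.univ : Finset (Fin 3)), c κ := by
      refine Finset.sum_le_sum_of_subset_of_nonneg (fun κ hκ => ?_) fun κ _ _ => hc κ
      exact Finset.mem_product.2 ⟨Finset.mem_image_of_mem _ hκ, Finset.mem_univ _⟩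
    have h2 : ∑ κ ∈ S.image Prod.fst ×ˢ (Finset.univ : Finset (Fin 3)), c κ ≤
        ∑ _i : Fin 3, ∑ _j : Fin 3, (2 * v.bd * ‖B‖) ^ 2 := by
      rw [Finset.sum_product_right]
      refine Finset.sum_le_sum fun i _ => ?_
      simp only [c]
      rw [Finset.sum_comm]
      refine Finset.sum_le_sum fun j _ => ?_
      have h3 := sum_norm_sq_repr_le scalarBasis (v.flux s i j B) (S.image Prod.fst)
      simp only [scalarBasis_repr] at h3
      exact h3.trans (pow_le_pow_left₀ (norm_nonneg _) (v.norm_flux_le s i j B) 2)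
    calc ∑ κ ∈ S, ‖drift v ε s κ B‖ ^ 2 ≤ ∑ κ ∈ S, ε⁻¹ * c κ :=
          Finset.sum_le_sum fun κ _ => norm_sq_drift_le v hε s κ B
      _ = ε⁻¹ * ∑ κ ∈ S, c κ := by rw [Finset.mul_sum]
      _ ≤ ε⁻¹ * ∑ _i : Fin 3, ∑ _j : Fin 3, (2 * v.bd * ‖B‖) ^ 2 := by
          have := h1.trans h2
          gcongr
      _ = _ := by
          simp only [Finset.sum_const, Finset.card_univ, Fintype.card_fin, nsmul_eq_mul]
          push_cast
          ring

/-- The symmetric tensor `k_i k_j` is contracted with the antisymmetric flux: the forcing is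
solenoidal in every mode. -/
theorem sum_mul_sqrt_smul_drift (v : BoundedVelocity) {ε : ℝ} (hε : 0 < ε) (s : ℝ)
    (k : Fin 3 → ℤ) (B : L2) :
    ∑ i, (k i : ℂ) * (√(heatRate ε (k, i)) • drift v ε s (k, i) B) = 0 := by
  simp only [sqrt_smul_drift v hε, Finset.mul_sum]
  have h : ∀ i j, (k i : ℂ) * (-(2 * Real.pi * Complex.I * k j) * coeff (v.flux s i j B) k) =
      -((k j : ℂ) * (-(2 * Real.pi * Complex.I * k i) * coeff (v.flux s j i B) k)) := by
    intro i j
    have : coeff (v.flux s j i B) k = -coeff (v.flux s i j B) k := by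
      rw [v.flux_swap, ← inner_monomialLp, ← inner_monomialLp, inner_neg_right]
    rw [this]
    ring
  have h2 : ∀ z : ℂ, z = -z → z = 0 := fun z hz => by
    have : (2 : ℂ) * z = 0 := by linear_combination hz
    simpa using this
  refine h2 _ ?_
  conv_lhs => rw [Finset.sum_comm]
  rw [← Finset.sum_neg_distrib]
  refine Finset.sum_congr rfl fun j _ => ?_
  rw [← Finset.sum_neg_distrib]
  exact Finset.sum_congr rfl fun i _ => h i j

/-- The induction equation preserves divergence-free fields. -/
theorem mem_L2div_of_isModeSolution (v : BoundedVelocity) {ε : ℝ} (hε : 0 < ε) {B : ℝ → L2}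
    (hB : Continuous B) (h : IsModeSolution fieldBasis (heatRate ε) (drift v ε) B)
    (h0 : B 0 ∈ L2div) {t : ℝ} (ht : 0 ≤ t) : B t ∈ L2div := by
  rw [mem_L2div_iff] at h0 ⊢
  intro k
  have ha := isDrift_drift v hε
  have h1 := (isModeSolution_iff_duhamel ha hB).1 h
  have hE : Continuous fun s : ℝ => Real.exp (heatRate ε (k, 0) * s) := by fun_prop
  have hint : ∀ i, IntervalIntegrable (fun s => (k i : ℂ) * (Real.exp (heatRate ε (k, i) * s) •
      √(heatRate ε (k, i)) • drift v ε s (k, i) (B s))) volume 0 t := fun i =>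
    ((((ha.locBdd hB (k, i)).smul (continuous_const (y := √(heatRate ε (k, i))))).smul
      hE).intervalIntegrable 0 t).const_mul _
  -- The heat rate depends on `k` and not on the component `i`, so the exponential factors out of
  -- the divergence and `k · B̂` obeys an unforced heat equation.
  have h2 : ∀ i, (k i : ℂ) * fieldBasis.repr (B t) (k, i) =
      Real.exp (-heatRate ε (k, 0) * t) • ((k i : ℂ) * fieldBasis.repr (B 0) (k, i) +
        ∫ s in (0 : ℝ)..t, (k i : ℂ) * (Real.exp (heatRate ε (k, i) * s) •
          √(heatRate ε (k, i)) • drift v ε s (k, i) (B s))) := by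
    intro i
    rw [h1 (k, i) t ht, duhamel, intervalIntegral.integral_const_mul, ← mul_add, mul_smul_comm]
    rfl
  simp only [h2]
  rw [← Finset.smul_sum, Finset.sum_add_distrib, h0, zero_add,
    ← intervalIntegral.integral_finsetSum fun i _ => hint i]
  have h3 : ∀ s, ∑ i, (k i : ℂ) * (Real.exp (heatRate ε (k, i) * s) •
      √(heatRate ε (k, i)) • drift v ε s (k, i) (B s)) = 0 := by
    intro s
    have h4 : ∀ i, (k i : ℂ) * (Real.exp (heatRate ε (k, i) * s) •
        √(heatRate ε (k, i)) • drift v ε s (k, i) (B s)) = Real.exp (heatRate ε (k, 0) * s) •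
        ((k i : ℂ) * (√(heatRate ε (k, i)) • drift v ε s (k, i) (B s))) :=
      fun i => mul_smul_comm _ _ _
    simp only [h4]
    rw [← Finset.smul_sum, sum_mul_sqrt_smul_drift v hε, smul_zero]
  simp only [h3, intervalIntegral.integral_zero, smul_zero]

/-! ### Weak solutions and the mode system -/

/-- The right-hand side of the weak form of the `i`-th component of the induction equation. -/
def weakRhs (v : BoundedVelocity) (ε s : ℝ) (i : Fin 3) (B : L2) (φ : T3 → ℂ) : ℂ :=
  ∑ j, (∫ x : T3, v.flux s i j B x * partialDeriv j φ x) +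
    ε * ∑ j, ∫ x : T3, comp i B x * partialDeriv j (partialDeriv j φ) x

theorem weakRhs_eq {u : T3 → EuclideanSpace ℝ (Fin 3)} (v : BoundedVelocity) (ε : ℝ) {s : ℝ}
    (huv : u =ᵐ[volume] v.toFun s) (i : Fin 3) (B : L2) {φ : T3 → ℂ} (hφ : IsTest φ) :
    (∫ x : T3, ∑ j : Fin 3, ((u x j : ℂ) * B x i - (u x i : ℂ) * B x j) * partialDeriv j φ x) +
      (ε : ℂ) * ∫ x : T3, B x i * laplacian φ x = weakRhs v ε s i B φ := by
  have h1 : ∫ x : T3, ∑ j : Fin 3, ((u x j : ℂ) * B x i - (u x i : ℂ) * B x j) *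
      partialDeriv j φ x = ∑ j, ∫ x : T3, v.flux s i j B x * partialDeriv j φ x := by
    rw [← integral_finsetSum _ fun j _ =>
      integrable_Lp_mul (v.flux s i j B) (continuous_partialDeriv j hφ)]
    refine integral_congr_ae ?_
    have h2 : ∀ᵐ x : T3, ∀ j, v.flux s i j B x =
        ((v.toFun s x j : ℝ) : ℂ) * B x i - ((v.toFun s x i : ℝ) : ℂ) * B x j :=
      ae_all_iff.2 fun j => v.coeFn_flux s i j B
    filter_upwards [h2, huv] with x hx hx'
    simp only [hx, hx']
  have h3 : ∫ x : T3, B x i * laplacian φ x =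
      ∑ j, ∫ x : T3, comp i B x * partialDeriv j (partialDeriv j φ) x := by
    rw [← integral_finsetSum _ fun j _ =>
      integrable_Lp_mul (comp i B) (continuous_partialDeriv j (hφ.partialDeriv j))]
    refine integral_congr_ae ?_
    filter_upwards [coeFn_comp i B] with x hx
    rw [hx, laplacian, Finset.mul_sum]
  rw [h1, h3, weakRhs]

theorem integral_mul_mFourier_neg (F : L2s) (k : Fin 3 → ℤ) :
    ∫ x : T3, F x * mFourier (-k) x = coeff F k := by
  simp only [coeff, mul_comm]

/-- The bridge to the abstract system: testing with the monomial of frequency `-k` isolates mode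
`k`. -/
theorem weakRhs_mFourier_neg (v : BoundedVelocity) {ε : ℝ} (hε : 0 < ε) (s : ℝ) (i : Fin 3)
    (B : L2) (k : Fin 3 → ℤ) :
    weakRhs v ε s i B (mFourier (-k)) =
      √(heatRate ε (k, i)) • drift v ε s (k, i) B - heatRate ε (k, i) • fieldBasis.repr B (k, i) := by
  have h1 : ∀ j, partialDeriv j (mFourier (-k)) =
      fun x => -(2 * Real.pi * Complex.I * k j) * mFourier (-k) x := fun j => by
    funext x
    rw [partialDeriv_mFourier, Pi.neg_apply]
    push_cast
    ring
  rw [sqrt_smul_drift v hε, fieldBasis_repr]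
  unfold weakRhs
  simp only [h1, partialDeriv_const_mul (isTest_mFourier (-k))]
  simp only [mul_left_comm _ (-(2 * (Real.pi : ℂ) * Complex.I * _)), integral_const_mul,
    integral_mul_mFourier_neg]
  rw [sub_eq_add_neg]
  congr 1
  rw [Complex.real_smul, heatRate]
  push_cast
  rw [Finset.mul_sum, Finset.mul_sum, Finset.sum_mul, ← Finset.sum_neg_distrib]
  refine Finset.sum_congr rfl fun j _ => ?_
  linear_combination (4 * Real.pi ^ 2 * ε * (k j : ℂ) ^ 2 * coeff (comp i B) k) * Complex.I_sq

theorem weakRhs_eq_pairing (v : BoundedVelocity) (ε s : ℝ) (i : Fin 3) (B : L2) {φ : T3 → ℂ}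
    (hφ : IsTest φ) :
    weakRhs v ε s i B φ = ∑ j, pairing (v.flux s i j B) (testLp (hφ.partialDeriv j)) +
      ε * ∑ j, pairing (comp i B) (testLp ((hφ.partialDeriv j).partialDeriv j)) := by
  simp only [weakRhs, pairing_testLp]

/-- The partial sums of the Fourier series of a test function. -/
def partialSum (φ : T3 → ℂ) (S : Finset (Fin 3 → ℤ)) : L2s := ∑ k ∈ S, coeff φ k • monomialLp k

theorem pairing_partialSum_partialDeriv (F : L2s) {φ : T3 → ℂ} (hφ : IsTest φ) (j : Fin 3)
    (S : Finset (Fin 3 → ℤ)) :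
    pairing F (partialSum (partialDeriv j φ) S) =
      ∑ k ∈ S, coeff φ k * ∫ x : T3, F x * partialDeriv j (mFourier k) x := by
  rw [partialSum, map_sum]
  refine Finset.sum_congr rfl fun k _ => ?_
  simp only [partialDeriv_mFourier, mul_left_comm _ (2 * (Real.pi : ℂ) * Complex.I * _),
    integral_const_mul]
  have h : coeff F (-k) = ∫ x : T3, F x * mFourier k x := by
    rw [← integral_mul_mFourier_neg, neg_neg]
  rw [map_smul, pairing_monomialLp, coeff_partialDeriv hφ, h, smul_eq_mul]
  ring

theorem pairing_partialSum_partialDeriv_partialDeriv (F : L2s) {φ : T3 → ℂ} (hφ : IsTest φ)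
    (j : Fin 3) (S : Finset (Fin 3 → ℤ)) :
    pairing F (partialSum (partialDeriv j (partialDeriv j φ)) S) =
      ∑ k ∈ S, coeff φ k * ∫ x : T3, F x * partialDeriv j (partialDeriv j (mFourier k)) x := by
  rw [pairing_partialSum_partialDeriv F (hφ.partialDeriv j)]
  refine Finset.sum_congr rfl fun k _ => ?_
  have h1 : partialDeriv j (mFourier k) = fun x => 2 * Real.pi * Complex.I * k j * mFourier k x :=
    funext fun x => partialDeriv_mFourier k j x
  rw [coeff_partialDeriv hφ]
  simp only [h1, partialDeriv_const_mul (isTest_mFourier k)]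
  simp only [mul_left_comm _ (2 * (Real.pi : ℂ) * Complex.I * _), integral_const_mul]
  ring

theorem sum_coeff_mul_weakRhs (v : BoundedVelocity) (ε s : ℝ) (i : Fin 3) (B : L2)
    {φ : T3 → ℂ} (hφ : IsTest φ) (S : Finset (Fin 3 → ℤ)) :
    ∑ k ∈ S, coeff φ k * weakRhs v ε s i B (mFourier k) =
      ∑ j, pairing (v.flux s i j B) (partialSum (partialDeriv j φ) S) +
        ε * ∑ j, pairing (comp i B) (partialSum (partialDeriv j (partialDeriv j φ)) S) := by
  simp only [pairing_partialSum_partialDeriv_partialDeriv _ hφ,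
    pairing_partialSum_partialDeriv _ hφ]
  rw [Finset.sum_comm, Finset.sum_comm (s := Finset.univ) (t := S), Finset.mul_sum,
    ← Finset.sum_add_distrib]
  refine Finset.sum_congr rfl fun k _ => ?_
  rw [weakRhs, mul_add, Finset.mul_sum, Finset.mul_sum, Finset.mul_sum, Finset.mul_sum]
  congr 1
  exact Finset.sum_congr rfl fun j _ => by ring

theorem hasSum_coeff_mul_weakRhs (v : BoundedVelocity) (ε s : ℝ) (i : Fin 3) (B : L2)
    {φ : T3 → ℂ} (hφ : IsTest φ) :
    HasSum (fun k => coeff φ k * weakRhs v ε s i B (mFourier k)) (weakRhs v ε s i B φ) := by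
  rw [weakRhs_eq_pairing v ε s i B hφ]
  unfold HasSum
  simp only [sum_coeff_mul_weakRhs v ε s i B hφ]
  have h : ∀ (F : L2s) {ψ : T3 → ℂ} (hψ : IsTest ψ),
      Tendsto (fun S => pairing F (partialSum ψ S)) atTop (𝓝 (pairing F (testLp hψ))) :=
    fun F ψ hψ => ((pairing F).continuous.tendsto _).comp (hasSum_testLp hψ)
  exact (tendsto_finsetSum _ fun j _ => h _ _).add
    ((tendsto_finsetSum _ fun j _ => h _ _).const_mul _)

/-- The Fourier sums of the first and second derivatives of `φ` converge in L², so they are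
eventually bounded. Uniformity in `s` supplies the dominating function for passing to the limit in
the time integral. -/
theorem norm_sum_coeff_mul_weakRhs_le (v : BoundedVelocity) {ε : ℝ} (hε : 0 < ε) (i : Fin 3)
    {φ : T3 → ℂ} (hφ : IsTest φ) :
    ∃ C, 0 ≤ C ∧ ∀ᶠ S in atTop, ∀ s B,
      ‖∑ k ∈ S, coeff φ k * weakRhs v ε s i B (mFourier k)‖ ≤ C * ‖B‖ := by
  have hev : ∀ {ψ : T3 → ℂ} (hψ : IsTest ψ), ∀ᶠ S in atTop,
      ‖partialSum ψ S‖ ≤ ‖testLp hψ‖ + 1 := fun {ψ} hψ =>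
    (((hasSum_testLp hψ).norm).eventually_lt_const (lt_add_one _)).mono fun S hS => hS.le
  have hv := v.bd_nonneg
  refine ⟨∑ j, 2 * v.bd * (‖testLp (hφ.partialDeriv j)‖ + 1) +
    ε * ∑ j, (‖testLp ((hφ.partialDeriv j).partialDeriv j)‖ + 1), by positivity, ?_⟩
  filter_upwards [eventually_all.2 fun j => hev (hφ.partialDeriv j),
    eventually_all.2 fun j => hev ((hφ.partialDeriv j).partialDeriv j)] with S h1 h2 s B
  rw [sum_coeff_mul_weakRhs v ε s i B hφ]
  refine (norm_add_le _ _).trans ?_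
  rw [norm_mul, Complex.norm_real, Real.norm_of_nonneg hε.le, add_mul, Finset.sum_mul, mul_assoc,
    Finset.sum_mul]
  refine add_le_add ((norm_sum_le _ _).trans (Finset.sum_le_sum fun j _ => ?_))
    (mul_le_mul_of_nonneg_left ((norm_sum_le _ _).trans (Finset.sum_le_sum fun j _ => ?_)) hε.le)
  · calc _ ≤ ‖v.flux s i j B‖ * ‖partialSum (partialDeriv j φ) S‖ := norm_pairing_le _ _
      _ ≤ (2 * v.bd * ‖B‖) * (‖testLp (hφ.partialDeriv j)‖ + 1) :=
        mul_le_mul (v.norm_flux_le s i j B) (h1 j) (norm_nonneg _) (by positivity)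
      _ = _ := by ring
  · calc _ ≤ ‖comp i B‖ * ‖partialSum (partialDeriv j (partialDeriv j φ)) S‖ := norm_pairing_le _ _
      _ ≤ ‖B‖ * (‖testLp ((hφ.partialDeriv j).partialDeriv j)‖ + 1) :=
        mul_le_mul (norm_comp_le i B) (h2 j) (norm_nonneg _) (norm_nonneg _)
      _ = _ := mul_comm _ _

theorem integral_comp_mul (B : L2) (i : Fin 3) (g : T3 → ℂ) :
    ∫ x : T3, B x i * g x = ∫ x : T3, comp i B x * g x := by
  refine integral_congr_ae ?_
  filter_upwards [coeFn_comp i B] with x hx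
  rw [hx]

theorem hasSum_coeff_mul_coeff (F : L2s) {φ : T3 → ℂ} (hφ : IsTest φ) :
    HasSum (fun k : Fin 3 → ℤ => coeff φ k * coeff F (-k)) (∫ x : T3, F x * φ x) := by
  have h := (hasSum_testLp hφ).mapL (pairing F)
  rw [pairing_testLp] at h
  refine h.congr_fun fun k => ?_
  rw [map_smul, pairing_monomialLp, smul_eq_mul]

/-- The extension of a curve on `[0, ∞)` that is constant for negative times. -/
def extendL2 (B : ℝ → L2div) (t : ℝ) : L2 := (B (max t 0) : L2)

theorem extendL2_of_nonneg (B : ℝ → L2div) {t : ℝ} (ht : 0 ≤ t) : extendL2 B t = (B t : L2) := by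
  rw [extendL2, max_eq_left ht]

theorem continuous_extendL2 {B : ℝ → L2div} (hB : ContinuousOn B (Set.Ici 0)) :
    Continuous (extendL2 B) :=
  continuous_subtype_val.comp
    (hB.comp_continuous (by fun_prop : Continuous fun t : ℝ => max t 0) fun t => le_max_right t 0)

theorem integral_weak_eq {u : ℝ → T3 → EuclideanSpace ℝ (Fin 3)} {v : BoundedVelocity}
    (huv : ∀ᵐ s ∂((volume : Measure ℝ).restrict (Set.Ici 0)), u s =ᵐ[volume] v.toFun s)
    (ε : ℝ) (B : ℝ → L2div) {φ : T3 → ℂ} (hφ : IsTest φ) (i : Fin 3) {t : ℝ} (ht : 0 ≤ t) :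
    ∫ s in (0 : ℝ)..t, ((∫ x : T3, ∑ j : Fin 3,
        ((u s x j : ℂ) * (B s : L2) x i - (u s x i : ℂ) * (B s : L2) x j) * partialDeriv j φ x) +
        (ε : ℂ) * ∫ x : T3, (B s : L2) x i * laplacian φ x) =
      ∫ s in (0 : ℝ)..t, weakRhs v ε s i (extendL2 B s) φ := by
  rw [ae_restrict_iff' measurableSet_Ici] at huv
  refine intervalIntegral.integral_congr_ae ?_
  filter_upwards [huv] with s hs hst
  rw [Set.uIoc_of_le ht] at hst
  rw [weakRhs_eq v ε (hs hst.1.le) i (B s) hφ, extendL2_of_nonneg B hst.1.le]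

/-- Monomials are test functions, so a weak solution satisfies every mode equation. Conversely the
mode equations are summed against the Fourier coefficients of `φ`, with dominated convergence in
time. -/
theorem isSolution_iff {u : ℝ → T3 → EuclideanSpace ℝ (Fin 3)} {v : BoundedVelocity}
    (huv : ∀ᵐ s ∂((volume : Measure ℝ).restrict (Set.Ici 0)), u s =ᵐ[volume] v.toFun s)
    {ε : ℝ} (hε : 0 < ε) (B₀ : L2div) (B : ℝ → L2div) :
    IsSolution u ε B₀ B ↔ ContinuousOn B (Set.Ici 0) ∧ B 0 = B₀ ∧
      IsModeSolution fieldBasis (heatRate ε) (drift v ε) (extendL2 B) := by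
  constructor
  · intro h
    refine ⟨h.continuousOn, h.initial, ?_⟩
    rintro ⟨k, i⟩ t ht
    have h1 := h.weak t ht _ (isTest_mFourier (-k)) i
    rw [integral_weak_eq huv ε B (isTest_mFourier (-k)) i ht, integral_comp_mul,
      integral_comp_mul, integral_mul_mFourier_neg, integral_mul_mFourier_neg] at h1
    simp only [weakRhs_mFourier_neg v hε] at h1
    rw [fieldBasis_repr, fieldBasis_repr, extendL2_of_nonneg B ht, extendL2_of_nonneg B le_rfl,
      h.initial]
    exact h1
  · rintro ⟨hc, h0, h⟩
    refine ⟨hc, h0, fun t ht φ hφ i => ?_⟩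
    have hB := continuous_extendL2 hc
    have ha := isDrift_drift v hε
    rw [integral_weak_eq huv ε B hφ i ht, integral_comp_mul, integral_comp_mul]
    have hmode : ∀ k, coeff (comp i (B t)) (-k) = coeff (comp i B₀) (-k) +
        ∫ s in (0 : ℝ)..t, weakRhs v ε s i (extendL2 B s) (mFourier k) := by
      intro k
      have h1 := h (-k, i) t ht
      rw [fieldBasis_repr, fieldBasis_repr, extendL2_of_nonneg B ht, extendL2_of_nonneg B le_rfl,
        h0] at h1
      refine h1.trans ?_
      congr 2
      funext s
      rw [← weakRhs_mFourier_neg v hε, neg_neg]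
    have hbdd : ∀ k, LocBdd fun s => weakRhs v ε s i (extendL2 B s) (mFourier k) := by
      intro k
      have h1 := ha.locBdd_rhs (e := fieldBasis) (lam := heatRate ε) hB (-k, i)
      simp only [← weakRhs_mFourier_neg v hε, neg_neg] at h1
      exact h1
    have hint : ∀ k, IntervalIntegrable (fun s => coeff φ k *
        weakRhs v ε s i (extendL2 B s) (mFourier k)) volume 0 t :=
      fun k => ((hbdd k).intervalIntegrable 0 t).const_mul _
    obtain ⟨C, hC0, hC⟩ := norm_sum_coeff_mul_weakRhs_le v hε i hφ
    have hlim : Tendsto (fun S : Finset (Fin 3 → ℤ) => ∫ s in (0 : ℝ)..t,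
        ∑ k ∈ S, coeff φ k * weakRhs v ε s i (extendL2 B s) (mFourier k)) atTop
        (𝓝 (∫ s in (0 : ℝ)..t, weakRhs v ε s i (extendL2 B s) φ)) := by
      refine intervalIntegral.tendsto_integral_filter_of_dominated_convergence
        (fun s => C * ‖extendL2 B s‖) (Eventually.of_forall fun S => ?_) ?_ ?_ ?_
      · exact (Finset.stronglyMeasurable_fun_sum _ fun k _ =>
          (hbdd k).meas.const_mul _).aestronglyMeasurable
      · filter_upwards [hC] with S hS
        exact Eventually.of_forall fun s _ => hS s _
      · exact (continuous_const.mul hB.norm).intervalIntegrable _ _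
      · exact Eventually.of_forall fun s _ => hasSum_coeff_mul_weakRhs v ε s i _ hφ
    have h2 : Tendsto (fun S => ∑ k ∈ S, coeff φ k * coeff (comp i B₀) (-k)) atTop _ :=
      hasSum_coeff_mul_coeff (comp i B₀) hφ
    refine tendsto_nhds_unique (hasSum_coeff_mul_coeff (comp i (B t)) hφ)
      ((h2.add hlim).congr fun S => ?_)
    rw [intervalIntegral.integral_finsetSum fun k _ => hint k, ← Finset.sum_add_distrib]
    refine Finset.sum_congr rfl fun k _ => ?_
    simp only [hmode, mul_add, intervalIntegral.integral_const_mul]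

/-! ### The solution operator and its growth rates -/

/-- A measurable representative is set to 0 wherever it exceeds the essential bound; taking `max M
0` lets the value 0 obey that bound too. -/
theorem exists_boundedVelocity {u : ℝ → T3 → EuclideanSpace ℝ (Fin 3)} (hu : MemLinftyW1infty u) :
    ∃ v : BoundedVelocity,
      ∀ᵐ s ∂((volume : Measure ℝ).restrict (Set.Ici 0)), u s =ᵐ[volume] v.toFun s := by
  obtain ⟨hmeas, M, hM⟩ := hu
  set w := hmeas.mk with hw
  have hwm : StronglyMeasurable w := hmeas.stronglyMeasurable_mk
  have hS : MeasurableSet {p : ℝ × T3 | ‖w p‖ ≤ max M 0} :=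
    measurableSet_le hwm.norm.measurable measurable_const
  refine ⟨⟨fun s x => Set.indicator {p : ℝ × T3 | ‖w p‖ ≤ max M 0} w (s, x), max M 0,
    hwm.indicator hS, fun s x => ?_⟩, ?_⟩
  · by_cases h : (s, x) ∈ {p : ℝ × T3 | ‖w p‖ ≤ max M 0}
    · rw [Set.indicator_of_mem h]
      exact h
    · rw [Set.indicator_of_notMem h, norm_zero]
      exact le_max_right _ _
  · filter_upwards [hM, Measure.ae_ae_of_ae_prod hmeas.ae_eq_mk] with s hs hs'
    filter_upwards [hs.2.1, hs'] with x hx hx'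
    have hx'' : u s x = w (s, x) := hx'
    rw [Set.indicator_of_mem, hx'']
    rw [Set.mem_ofPred_eq, ← hx'']
    exact hx.trans (le_max_left _ _)

theorem drift_congr {v : BoundedVelocity} {s s' : ℝ} (h : v.toFun s =ᵐ[volume] v.toFun s')
    (ε : ℝ) (κ : (Fin 3 → ℤ) × Fin 3) (B : L2) : drift v ε s κ B = drift v ε s' κ B := by
  simp only [drift_apply, v.flux_congr h]

/-- Lattice points in a ball. Integers satisfy `|n| ≤ n ^ 2`, so the crude box of side `N` suffices.
-/
theorem finite_setOf_heatRate_lt {ε : ℝ} (hε : 0 < ε) (m : ℝ) : {κ | heatRate ε κ < m}.Finite := by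
  have hc : 0 < 4 * Real.pi ^ 2 * ε := by have := Real.pi_pos; positivity
  obtain ⟨N, hN⟩ := exists_nat_ge (m / (4 * Real.pi ^ 2 * ε))
  refine Set.Finite.subset (((Set.Finite.pi fun _ : Fin 3 =>
    Set.finite_Icc (-(N : ℤ)) N)).prod (Set.finite_univ (α := Fin 3))) ?_
  rintro ⟨k, i⟩ hk
  refine ⟨fun j _ => ?_, Set.mem_univ _⟩
  have h1 : ∑ j, (k j : ℝ) ^ 2 < N := by
    refine lt_of_lt_of_le ?_ hN
    rw [lt_div_iff₀ hc, mul_comm]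
    exact hk
  have h2 : (k j : ℝ) ^ 2 < N := lt_of_le_of_lt
    (Finset.single_le_sum (f := fun j => (k j : ℝ) ^ 2) (fun j _ => sq_nonneg _)
      (Finset.mem_univ j)) h1
  have h3 : k j ^ 2 < (N : ℤ) := by exact_mod_cast h2
  have h4 : |k j| ≤ k j ^ 2 := by
    rw [← sq_abs]
    exact Int.le_self_sq _
  exact abs_le.1 (by lia)

/-! ### Change of drift, and uniform smallness of the high modes. -/

section ModeSystem

variable {ι H : Type*} [NormedAddCommGroup H] [InnerProductSpace ℂ H]
  {e : HilbertBasis ι ℂ H} {lam : ι → ℝ} {a : ℝ → ι → H →L[ℂ] ℂ}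

theorem IsModeSolution.congr {B C : ℝ → H} {a' : ℝ → ι → H →L[ℂ] ℂ} (h : IsModeSolution e lam a B)
    (hBC : ∀ t, 0 ≤ t → C t = B t)
    (ha : ∀ᵐ s ∂((volume : Measure ℝ).restrict (Set.Ici 0)), ∀ κ x, a' s κ x = a s κ x) :
    IsModeSolution e lam a' C := by
  intro κ t ht
  rw [hBC t ht, hBC 0 le_rfl, h κ t ht]
  congr 1
  rw [ae_restrict_iff' measurableSet_Ici] at ha
  refine intervalIntegral.integral_congr_ae ?_
  filter_upwards [ha] with s hs hst
  rw [Set.uIoc_of_le ht] at hst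
  rw [hs hst.1.le, hBC s hst.1.le]

theorem IsModeSolution.exists_tail_bound [SecondCountableTopology H] {K : ℝ} (ha : IsDrift a K)
    (hlam : ∀ κ, 0 ≤ lam κ) (hfin : ∀ m, {κ | lam κ < m}.Finite) {t η : ℝ} (ht : 0 < t)
    (hη : 0 < η) :
    ∃ S₀ : Finset ι, ∀ S : Finset ι, Disjoint S S₀ → ∀ B : ℝ → H, Continuous B →
      IsModeSolution e lam a B → ∑ κ ∈ S, ‖e.repr (B t) κ‖ ^ 2 ≤ η * ‖B 0‖ ^ 2 := by
  have hK := ha.nonneg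
  set c := 4 * Real.exp (K * t) with hc
  have hc0 : 0 < c := by positivity
  -- The window `δ` is chosen first, to make the forcing small, and then `m`, to make the decay over
  -- that window strong. Neither depends on the solution.
  obtain ⟨δ, hδ0, hδt, hδ⟩ : ∃ δ, 0 < δ ∧ δ ≤ t ∧ c * (K * δ) ≤ η / 2 := by
    refine ⟨min t (η / (2 * c * (K + 1))), by positivity, min_le_left _ _, ?_⟩
    calc c * (K * min t (η / (2 * c * (K + 1))))
        ≤ c * ((K + 1) * (η / (2 * c * (K + 1)))) := by
          gcongr
          · linarith
          · exact min_le_right _ _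
      _ = η / 2 := by field_simp
  obtain ⟨m, hm⟩ : ∃ m : ℝ, c * Real.exp (-2 * m * δ) ≤ η / 2 := by
    have h1 : Tendsto (fun m : ℝ => c * Real.exp (-(2 * δ * m))) atTop (𝓝 (c * 0)) :=
      (Real.tendsto_exp_neg_atTop_nhds_zero.comp
        (tendsto_id.const_mul_atTop (by positivity : 0 < 2 * δ))).const_mul c
    rw [mul_zero] at h1
    obtain ⟨m, hm⟩ := (h1.eventually_le_const (half_pos hη)).exists
    exact ⟨m, by rwa [show -2 * m * δ = -(2 * δ * m) by ring]⟩
  refine ⟨(hfin m).toFinset, fun S hS B hB h => ?_⟩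
  refine (h.sum_norm_sq_repr_le ha hlam hB (m := m) (fun κ hκ => ?_) hδ0.le hδt).trans ?_
  · by_contra! hlt
    exact Finset.disjoint_left.1 hS hκ ((hfin m).mem_toFinset.2 hlt)
  · gcongr
    rw [mul_add]
    linarith

end ModeSystem

/-! ### Well-posedness, the monodromy operator and its iterates. -/

section Solutions

variable {u : ℝ → T3 → EuclideanSpace ℝ (Fin 3)} {v : BoundedVelocity}
  (huv : ∀ᵐ s ∂((volume : Measure ℝ).restrict (Set.Ici 0)), u s =ᵐ[volume] v.toFun s)
  {ε : ℝ} (hε : 0 < ε) {B₀ C₀ : L2div} {B C : ℝ → L2div}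

include huv hε

theorem exists_isSolution (B₀ : L2div) : ∃ B, IsSolution u ε B₀ B := by
  obtain ⟨A, hA, hA0, h⟩ := exists_isModeSolution (e := fieldBasis) (isDrift_drift v hε)
    (heatRate_nonneg hε.le) (B₀ : L2)
  have hmem : ∀ t, 0 ≤ t → A t ∈ L2div := fun t ht =>
    mem_L2div_of_isModeSolution v hε hA h (hA0 ▸ B₀.2) ht
  refine ⟨fun t => ⟨A (max t 0), hmem _ (le_max_right _ _)⟩, (isSolution_iff huv hε _ _).2
    ⟨?_, ?_, h.congr (fun t ht => ?_) (Eventually.of_forall fun _ _ _ => rfl)⟩⟩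
  · exact (Continuous.subtype_mk (hA.comp (by fun_prop)) _).continuousOn
  · exact Subtype.ext (by simp [hA0])
  · simp [extendL2, ht]

namespace IsSolution

theorem eqOn (h : IsSolution u ε B₀ B) (h' : IsSolution u ε B₀ C) : Set.EqOn B C (Set.Ici 0) := by
  obtain ⟨hc, h0, hm⟩ := (isSolution_iff huv hε _ _).1 h
  obtain ⟨hc', h0', hm'⟩ := (isSolution_iff huv hε _ _).1 h'
  intro t ht
  have h1 := hm.eq_of_apply_zero_eq (isDrift_drift v hε) (heatRate_nonneg hε.le)
    (continuous_extendL2 hc) (continuous_extendL2 hc') hm'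
    (by rw [extendL2_of_nonneg B le_rfl, extendL2_of_nonneg C le_rfl, h0, h0']) ht
  rw [extendL2_of_nonneg B ht, extendL2_of_nonneg C ht] at h1
  exact Subtype.ext h1

theorem add_smul (h : IsSolution u ε B₀ B) (h' : IsSolution u ε C₀ C) (z : ℂ) :
    IsSolution u ε (B₀ + z • C₀) (fun t => B t + z • C t) := by
  obtain ⟨hc, h0, hm⟩ := (isSolution_iff huv hε _ _).1 h
  obtain ⟨hc', h0', hm'⟩ := (isSolution_iff huv hε _ _).1 h'
  refine (isSolution_iff huv hε _ _).2 ⟨hc.add (hc'.const_smul z), by rw [h0, h0'], ?_⟩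
  exact (hm.add_smul (isDrift_drift v hε) (continuous_extendL2 hc) (continuous_extendL2 hc') hm' z)

theorem norm_sq_le_of_le (h : IsSolution u ε B₀ B) {s t : ℝ} (hs : 0 ≤ s) (hst : s ≤ t) :
    ‖B t‖ ^ 2 ≤ 2 * ‖B s‖ ^ 2 * Real.exp (ε⁻¹ * (36 * v.bd ^ 2) * (t - s)) := by
  obtain ⟨hc, h0, hm⟩ := (isSolution_iff huv hε _ _).1 h
  have h1 := hm.norm_sq_le_of_le (isDrift_drift v hε) (heatRate_nonneg hε.le)
    (continuous_extendL2 hc) hs hst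
  rwa [extendL2_of_nonneg B hs, extendL2_of_nonneg B (hs.trans hst)] at h1

theorem exists_norm_le (τ : ℝ) :
    ∃ D > 0, ∀ (B₀ : L2div) (B : ℝ → L2div), IsSolution u ε B₀ B →
      ∀ s t, 0 ≤ s → s ≤ t → t ≤ s + τ → ‖B t‖ ≤ D * ‖B s‖ := by
  refine ⟨√(2 * Real.exp (ε⁻¹ * (36 * v.bd ^ 2) * τ)), by positivity,
    fun B₀ B h s t hs hst hts => ?_⟩
  refine le_of_sq_le_sq ?_ (by positivity)
  rw [mul_pow, Real.sq_sqrt (by positivity)]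
  refine (h.norm_sq_le_of_le huv hε hs hst).trans ?_
  have : Real.exp (ε⁻¹ * (36 * v.bd ^ 2) * (t - s)) ≤ Real.exp (ε⁻¹ * (36 * v.bd ^ 2) * τ) := by
    gcongr
    linarith
  nlinarith [sq_nonneg ‖B s‖]

/-- The drift depends on the velocity only up to null sets, so periodicity at almost every time
suffices for the translated mode system to coincide with the original. -/
theorem shift {τ : ℝ} (hτ : 0 ≤ τ) (hper : IsTimePeriodic τ u) (h : IsSolution u ε B₀ B) :
    IsSolution u ε (B τ) (fun t => B (τ + t)) := by
  obtain ⟨hc, h0, hm⟩ := (isSolution_iff huv hε _ _).1 h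
  have hB := continuous_extendL2 hc
  refine (isSolution_iff huv hε _ _).2 ⟨?_, by rw [add_zero], ?_⟩
  · exact hc.comp (by fun_prop) fun t (ht : 0 ≤ t) => add_nonneg hτ ht
  · refine (hm.shift (fun κ => (isDrift_drift v hε).locBdd_rhs hB κ) hτ).congr (fun t ht => ?_) ?_
    · rw [extendL2_of_nonneg _ ht, extendL2_of_nonneg B (add_nonneg hτ ht)]
    · have huv' : ∀ᵐ s : ℝ, 0 ≤ s → u s =ᵐ[volume] v.toFun s :=
        (ae_restrict_iff' measurableSet_Ici).1 huv
      have h1 : ∀ᵐ s : ℝ, 0 ≤ τ + s → u (τ + s) =ᵐ[volume] v.toFun (τ + s) :=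
        (measurePreserving_add_left volume τ).quasiMeasurePreserving.ae huv'
      have h2 : ∀ᵐ s : ℝ, 0 ≤ s → u (s + τ) =ᵐ[volume] u s :=
        (ae_restrict_iff' measurableSet_Ici).1 hper
      rw [ae_restrict_iff' measurableSet_Ici]
      filter_upwards [huv', h1, h2] with s hs1 hs2 hs3 hs κ x
      refine drift_congr ?_ ε κ x
      have h3 := hs3 hs
      rw [add_comm s τ] at h3
      exact (hs1 hs).symm.trans (h3.symm.trans (hs2 (add_nonneg hτ hs)))

end IsSolution

/-- The monodromy operator over a time `τ` exists and is compact. -/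
theorem exists_isMonodromy {τ : ℝ} (hτ : 0 < τ) :
    ∃ T : L2div →L[ℂ] L2div, IsMonodromy u ε τ T ∧ IsCompactOperator T := by
  choose F hF using fun B₀ => exists_isSolution huv hε B₀
  have huniq : ∀ {B₀ B}, IsSolution u ε B₀ B → B τ = F B₀ τ := fun h =>
    h.eqOn huv hε (hF _) hτ.le
  obtain ⟨D, -, hD⟩ := IsSolution.exists_norm_le huv hε τ
  have hadd : ∀ x y (z : ℂ), F (x + z • y) τ = F x τ + z • F y τ := fun x y z =>
    (huniq ((hF x).add_smul huv hε (hF y) z)).symm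
  have hzero : F 0 τ = 0 := by
    have h := hD 0 _ (hF 0) 0 τ le_rfl hτ.le (by simp)
    rw [(hF 0).initial, norm_zero, mul_zero] at h
    exact norm_le_zero_iff.1 h
  let L : L2div →ₗ[ℂ] L2div :=
    { toFun := fun x => F x τ
      map_add' := fun x y => by simpa using hadd x y 1
      map_smul' := fun z y => by simpa [hzero] using hadd 0 y z }
  let T : L2div →L[ℂ] L2div := L.mkContinuous D fun x => by
    have h := hD x _ (hF x) 0 τ le_rfl hτ.le (by simp)
    rwa [(hF x).initial] at h
  have hT : ∀ x, T x = F x τ := fun _ => rfl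
  refine ⟨T, fun B₀ B h => huniq h, ?_⟩
  -- The Fourier basis lives in the whole of L², so compactness is proved there and then restricted
  -- to the closed subspace `L2div`.
  have h1 : IsCompactOperator (L2div.subtypeL ∘L T) := by
    refine isCompactOperator_of_sum_norm_sq_repr_le fieldBasis fun η hη => ?_
    obtain ⟨S₀, hS₀⟩ := IsModeSolution.exists_tail_bound (e := fieldBasis) (isDrift_drift v hε)
      (heatRate_nonneg hε.le) (finite_setOf_heatRate_lt hε) hτ hη
    refine ⟨S₀, fun S hS x => ?_⟩
    obtain ⟨hc, h0, hm⟩ := (isSolution_iff huv hε _ _).1 (hF x)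
    have h2 := hS₀ S hS _ (continuous_extendL2 hc) hm
    rwa [extendL2_of_nonneg _ hτ.le, extendL2_of_nonneg _ le_rfl, h0] at h2
  exact h1.codRestrict (fun x => (T x).2) isClosed_L2div

/-- The induction runs over all data at once: the solution shifted by one period starts from `T B₀`,
and `(T ^ n) (T B₀) = (T ^ (n + 1)) B₀`. -/
theorem IsSolution.isSampledBy {τ : ℝ} (hτ : 0 ≤ τ) (hper : IsTimePeriodic τ u)
    {T : L2div →L[ℂ] L2div} (hT : IsMonodromy u ε τ T) (h : IsSolution u ε B₀ B) :
    IsSampledBy τ T B₀ B where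
  apply_nat_mul n := by
    induction n generalizing B₀ B with
    | zero => simpa using h.initial
    | succ n ih =>
      have h1 := ih (h.shift huv hε hτ hper)
      rw [hT B₀ B h] at h1
      rw [pow_succ, mul_apply_eq_comp, ← h1]
      congr 1
      push_cast
      ring
  exists_bound := by
    obtain ⟨D, hD0, hD⟩ := IsSolution.exists_norm_le huv hε τ
    exact ⟨D, hD0, hD B₀ B h⟩

end Solutions

end KinematicDynamo

end

theorem lemma2p5
    (u : ℝ → KinematicDynamo.T3 → EuclideanSpace ℝ (Fin 3)) (τ : ℝ) (hτ : 0 < τ)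
    (hu : KinematicDynamo.MemLinftyW1infty u) (hdiv : KinematicDynamo.IsDivFree u)
    (hper : KinematicDynamo.IsTimePeriodic τ u) (ε : ℝ) (hε : 0 < ε) :
    -- well-posedness: a solution exists for every datum and is unique on `[0,∞)`
    (∀ B₀ : KinematicDynamo.L2div, ∃ B : ℝ → KinematicDynamo.L2div,
      KinematicDynamo.IsSolution u ε B₀ B ∧
        ∀ B' : ℝ → KinematicDynamo.L2div, KinematicDynamo.IsSolution u ε B₀ B' →
          Set.EqOn B' B (Set.Ici 0)) ∧
    -- the two growth rates agree for every datum
    (∀ (B₀ : KinematicDynamo.L2div) (B : ℝ → KinematicDynamo.L2div),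
      KinematicDynamo.IsSolution u ε B₀ B →
        KinematicDynamo.growthRate B = KinematicDynamo.limsupGrowthRate B) ∧
    -- the optimal rates are both given by the spectral radius of the compact monodromy operator,
    -- and are attained
    (∃ T : KinematicDynamo.L2div →L[ℂ] KinematicDynamo.L2div,
      KinematicDynamo.IsMonodromy u ε τ T ∧ IsCompactOperator T ∧
        IsGreatest {γ : EReal | ∃ B₀ B, B₀ ≠ 0 ∧ KinematicDynamo.IsSolution u ε B₀ B ∧
            γ = KinematicDynamo.growthRate B}
          (((τ⁻¹ : ℝ) : EReal) * ENNReal.log (spectralRadius ℂ T)) ∧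
        IsGreatest {γ : EReal | ∃ B₀ B, B₀ ≠ 0 ∧ KinematicDynamo.IsSolution u ε B₀ B ∧
            γ = KinematicDynamo.limsupGrowthRate B}
          (((τ⁻¹ : ℝ) : EReal) * ENNReal.log (spectralRadius ℂ T))) := by
  obtain ⟨v, huv⟩ := KinematicDynamo.exists_boundedVelocity hu
  obtain ⟨T, hT, hTc⟩ := KinematicDynamo.exists_isMonodromy huv hε hτ
  have hex := KinematicDynamo.exists_isSolution huv hε
  have hrate : ∀ (B₀ : KinematicDynamo.L2div) (B : ℝ → KinematicDynamo.L2div),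
      KinematicDynamo.IsSolution u ε B₀ B →
        KinematicDynamo.growthRate B = KinematicDynamo.limsupGrowthRate B := fun B₀ B h =>
    (h.isSampledBy huv hε hτ.le hper hT).liminf_rate_eq_limsup_rate hτ hTc
  have hle : ∀ (B₀ : KinematicDynamo.L2div) (B : ℝ → KinematicDynamo.L2div),
      KinematicDynamo.IsSolution u ε B₀ B → KinematicDynamo.limsupGrowthRate B ≤
        ((τ⁻¹ : ℝ) : EReal) * ENNReal.log (spectralRadius ℂ T) := fun B₀ B h =>
    (h.isSampledBy huv hε hτ.le hper hT).limsup_rate_le_log_spectralRadius hτ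
  obtain ⟨x, hx0, hx⟩ := KinematicDynamo.exists_log_spectralRadius_le_liminf_rate hτ hTc
  obtain ⟨B, hB⟩ := hex x
  -- The rate of the solution from `x` is squeezed between the lower bound on its liminf and
  -- Gelfand's bound on its limsup, so one datum attains both maxima.
  have hmax : ((τ⁻¹ : ℝ) : EReal) * ENNReal.log (spectralRadius ℂ T) =
      KinematicDynamo.limsupGrowthRate B :=
    le_antisymm ((hx B (hB.isSampledBy huv hε hτ.le hper hT)).trans (hrate x B hB).le) (hle x B hB)
  refine ⟨fun B₀ => ?_, hrate, T, hT, hTc, ⟨⟨x, B, hx0, hB, hmax.trans (hrate x B hB).symm⟩, ?_⟩,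
    ⟨x, B, hx0, hB, hmax⟩, ?_⟩
  · obtain ⟨B, hB⟩ := hex B₀
    exact ⟨B, hB, fun B' hB' => hB'.eqOn huv hε hB⟩
  · rintro _ ⟨B₀, B, -, hB, rfl⟩
    exact (hrate B₀ B hB).trans_le (hle B₀ B hB)
  · rintro _ ⟨B₀, B, -, hB, rfl⟩
    exact hle B₀ B hB
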